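/- Let $N\ge 1$ and $\rho_0,\dots,\rho_{N-1}>0$. Let $\mathcal H=\prod_{j=0}^{N-1}L^2(j,j+1)$ (complex valued) with inner product $\langle u,\tilde u\rangle=\sum_{j}\int_j^{j+1}u_j\overline{\tilde u_j}\,dx$. Let $\mathcal A u=(-i\rho_j\,\partial_x^2u_j)_{0\le j\le N-1}$, where $\mathcal D(\mathcal A)$ consists of all $u\in\prod_{j=0}^{N-1}H^2(j,j+1)$ such that $$\rho_0\,\partial_xu_0(0)=i\,u_0(0),\qquad u_{N-1}(N)=0,$$ $$u_{j-1}(j)=u_j(j),\qquad -\rho_{j-1}\,\partial_xu_{j-1}(j)+\rho_j\,\partial_xu_j(j)=0,\qquad j=1,\dots,N-1.$$ For $u^0\in\mathcal H$, a solution of $$(S)\qquad u'=\mathcal A u,\quad u(0)=u^0,$$ is a function $u\in C([0,\infty),\mathcal H)$ such that $\int_0^tu(s)\,ds\in\mathcal D(\mathcal A)$ and $u(t)=u^0+\mathcal A\int_0^tu(s)\,ds$ for all $t\ge0$. Put $E(t)=\frac12\sum_{j=0}^{N-1}\int_j^{j+1}|u_j(t,x)|^2\,dx$. Then the following hold. (0)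 $\mathcal A$ is m-dissipative on $\mathcal H$: $\operatorname{Re}\langle\mathcal Au,u\rangle\le0$ for all $u\in\mathcal D(\mathcal A)$, and $\lambda I-\mathcal A:\mathcal D(\mathcal A)\to\mathcal H$ is onto for every $\lambda>0$. (i) For every $u^0\in\mathcal H$ there is a unique solution $u\in C([0,\infty),\mathcal H)$ of $(S)$. If $u^0\in\mathcal D(\mathcal A)$, then $u\in C([0,\infty),\mathcal D(\mathcal A))\cap C^1([0,\infty),\mathcal H)$, where $\mathcal D(\mathcal A)$ carries the graph norm, and $u'(t)=\mathcal Au(t)$ for all $t\ge0$; conversely, every function with these properties and $u(0)=u^0$ is the solution. (ii) If $u^0\in\mathcal D(\mathcal A)$, then $E'(t)=-|u_0(t,0)|^2\le0$ for all $t\ge0$ (a one-sided derivative at $t=0$). The energy $E$ is nonincreasing on $[0,\infty)$ for the solution with any initial datum $u^0\in\mathcal H$. -/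

import Mathlib

open MeasureTheory Set
open scoped ContDiff

noncomputable section

namespace SchrodingerChain

/-! ### Evolution equations `u' = A u` for an unbounded operator `A` -/

/-- `A` is m-dissipative: `Re ⟨A x, x⟩ ≤ 0` on the domain, and `l I - A` is onto for all `l > 0`. -/
structure IsMDissipative {E : Type*} [NormedAddCommGroup E] [InnerProductSpace ℂ E]
    (A : E →ₗ.[ℂ] E) : Prop where
  dissipative : ∀ x : A.domain, (inner ℂ (A x) (x : E)).re ≤ 0
  maximal : ∀ l : ℝ, 0 < l → ∀ f : E, ∃ x : A.domain, (l : ℂ) • (x : E) - A x = f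

/-- `u ∈ C([0,∞), E)` is a (mild) solution of `u' = A u`, `u(0) = u₀`: for every `t ≥ 0` the
integral `∫₀ᵗ u(s) ds` lies in the domain of `A` and `u(t) = u₀ + A ∫₀ᵗ u(s) ds`. -/
structure IsMildSolution {E : Type*} [NormedAddCommGroup E] [NormedSpace ℂ E]
    (A : E →ₗ.[ℂ] E) (u₀ : E) (u : ℝ → E) : Prop where
  continuousOn : ContinuousOn u (Ici 0)
  integrated : ∀ t : ℝ, 0 ≤ t →
    ∃ h : (∫ s in (0 : ℝ)..t, u s) ∈ A.domain, u t = u₀ + A ⟨∫ s in (0 : ℝ)..t, u s, h⟩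

/-- `u ∈ C([0,∞), D(A)) ∩ C¹([0,∞), E)`, `u(0) = u₀` and `u'(t) = A u(t)` for all `t ≥ 0`
(a one-sided derivative at `t = 0`). The domain `D(A)` carries the graph norm, so continuity into
`D(A)` is continuity of `t ↦ (u(t), A u(t))`. -/
structure IsClassicalSolution {E : Type*} [NormedAddCommGroup E] [NormedSpace ℂ E]
    (A : E →ₗ.[ℂ] E) (u₀ : E) (u : ℝ → E) : Prop where
  initial : u 0 = u₀
  contDiffOn : ContDiffOn ℝ 1 u (Ici 0)
  mem_domain : ∀ t : ℝ, 0 ≤ t → u t ∈ A.domain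
  continuous_graph :
    Continuous fun t : Ici (0 : ℝ) => (u t, A ⟨u t, mem_domain t t.2⟩)
  equation : ∀ (t : ℝ) (ht : 0 ≤ t), HasDerivWithinAt u (A ⟨u t, mem_domain t ht⟩) (Ici 0) t

/-! ### Sobolev functions on an interval -/

/-- The complex Hilbert space `L²(a,b)`. -/
abbrev L2 (a b : ℝ) : Type := Lp ℂ 2 (volume.restrict (Ioo a b))

/-- `g ∈ L²(a,b)` is the weak derivative of `f ∈ L²(a,b)`:
`∫ f φ' = - ∫ g φ` for all `φ ∈ C_c^∞(a,b)`. -/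
def IsWeakDeriv {a b : ℝ} (f g : L2 a b) : Prop :=
  ∀ φ : ℝ → ℝ, ContDiff ℝ ∞ φ → HasCompactSupport φ → tsupport φ ⊆ Ioo a b →
    ∫ x in Ioo a b, deriv φ x • f x = -∫ x in Ioo a b, φ x • g x

/-- `F` is the representative of `f ∈ L²(a,b)` that is continuous on `[a,b]`. Every `f ∈ H¹(a,b)`
has one, and for `a < b` its values on `[a,b]`, in particular the boundary values `F a` and `F b`,
are determined by `f`. -/
def IsContRep {a b : ℝ} (f : L2 a b) (F : ℝ → ℂ) : Prop :=
  ContinuousOn F (Icc a b) ∧ f =ᵐ[volume.restrict (Ioo a b)] F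

lemma integrable_smul_L2 {a b : ℝ} (f : L2 a b) {ψ : ℝ → ℝ} (hψ : Continuous ψ)
    (hc : HasCompactSupport ψ) :
    Integrable (fun x => ψ x • f x) (volume.restrict (Ioo a b)) := by
  have hf : Integrable f (volume.restrict (Ioo a b)) :=
    (Lp.memLp f).integrable (by norm_num)
  obtain ⟨C, hC⟩ := hc.exists_bound_of_continuous hψ
  exact hf.bdd_smul C hψ.aestronglyMeasurable (Filter.Eventually.of_forall hC)

lemma IsWeakDeriv.zero {a b : ℝ} : IsWeakDeriv (0 : L2 a b) 0 := by
  intro φ _ _ _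
  have h := Lp.coeFn_zero ℂ 2 (volume.restrict (Ioo a b))
  have h₁ : ∫ x in Ioo a b, deriv φ x • (0 : L2 a b) x = 0 :=
    integral_eq_zero_of_ae (by filter_upwards [h] with x hx; rw [hx]; exact smul_zero _)
  have h₂ : ∫ x in Ioo a b, φ x • (0 : L2 a b) x = 0 :=
    integral_eq_zero_of_ae (by filter_upwards [h] with x hx; rw [hx]; exact smul_zero _)
  rw [h₁, h₂, neg_zero]

lemma integral_smul_add {a b : ℝ} (f g : L2 a b) {ψ : ℝ → ℝ} (hψ : Continuous ψ)
    (hc : HasCompactSupport ψ) :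
    ∫ x in Ioo a b, ψ x • (f + g) x
      = (∫ x in Ioo a b, ψ x • f x) + ∫ x in Ioo a b, ψ x • g x := by
  rw [← integral_add (integrable_smul_L2 f hψ hc) (integrable_smul_L2 g hψ hc)]
  refine integral_congr_ae ?_
  filter_upwards [Lp.coeFn_add f g] with x hx
  rw [hx]
  exact smul_add _ _ _

lemma integral_smul_smul {a b : ℝ} (c : ℂ) (f : L2 a b) (ψ : ℝ → ℝ) :
    ∫ x in Ioo a b, ψ x • (c • f) x = c * ∫ x in Ioo a b, ψ x • f x := by
  rw [← integral_const_mul]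
  refine integral_congr_ae ?_
  filter_upwards [Lp.coeFn_smul c f] with x hx
  rw [hx]
  exact smul_comm (ψ x) c (f x)

lemma IsWeakDeriv.add {a b : ℝ} {f f' g g' : L2 a b} (hf : IsWeakDeriv f f')
    (hg : IsWeakDeriv g g') : IsWeakDeriv (f + g) (f' + g') := by
  intro φ h₁ h₂ h₃
  rw [integral_smul_add _ _ (h₁.continuous_deriv (by simp)) h₂.deriv,
    integral_smul_add _ _ h₁.continuous h₂, hf φ h₁ h₂ h₃, hg φ h₁ h₂ h₃, neg_add]

lemma IsWeakDeriv.smul {a b : ℝ} {f f' : L2 a b} (c : ℂ) (hf : IsWeakDeriv f f') :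
    IsWeakDeriv (c • f) (c • f') := by
  intro φ h₁ h₂ h₃
  rw [integral_smul_smul, integral_smul_smul, hf φ h₁ h₂ h₃, mul_neg]

lemma IsWeakDeriv.unique {a b : ℝ} {f g h : L2 a b} (hg : IsWeakDeriv f g)
    (hh : IsWeakDeriv f h) : g = h := by
  have hgi : Integrable g (volume.restrict (Ioo a b)) := (Lp.memLp g).integrable (by norm_num)
  have hhi : Integrable h (volume.restrict (Ioo a b)) := (Lp.memLp h).integrable (by norm_num)
  have key : ∀ᵐ x, x ∈ Ioo a b → g x - h x = 0 := by
    refine IsOpen.ae_eq_zero_of_integral_contDiff_smul_eq_zero isOpen_Ioo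
      (f := fun x => g x - h x) ?_ ?_
    · exact IntegrableOn.locallyIntegrableOn (hgi.sub hhi)
    · intro φ h₁ h₂ h₃
      have e : ∫ x in Ioo a b, φ x • g x = ∫ x in Ioo a b, φ x • h x :=
        neg_injective ((hg φ h₁ h₂ h₃).symm.trans (hh φ h₁ h₂ h₃))
      have hs : Function.support (fun x => φ x • (g x - h x)) ⊆ Ioo a b := by
        intro x hx
        refine h₃ (subset_tsupport _ ?_)
        intro h0
        exact hx (by simp [h0])
      rw [← setIntegral_eq_integral_of_forall_compl_eq_zero
        (fun x hx => by by_contra h0; exact hx (hs h0))]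
      simp only [smul_sub]
      rw [integral_sub (integrable_smul_L2 g h₁.continuous h₂)
        (integrable_smul_L2 h h₁.continuous h₂), e, sub_self]
  refine Lp.ext ?_
  rw [Filter.EventuallyEq, ae_restrict_iff' measurableSet_Ioo]
  filter_upwards [key] with x hx hm
  exact sub_eq_zero.mp (hx hm)

lemma IsContRep.zero {a b : ℝ} : IsContRep (0 : L2 a b) 0 :=
  ⟨continuousOn_const, Lp.coeFn_zero ℂ 2 _⟩

lemma IsContRep.add {a b : ℝ} {f g : L2 a b} {F G : ℝ → ℂ} (hf : IsContRep f F)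
    (hg : IsContRep g G) : IsContRep (f + g) (F + G) :=
  ⟨hf.1.add hg.1, (Lp.coeFn_add f g).trans (hf.2.add hg.2)⟩

lemma IsContRep.smul {a b : ℝ} {f : L2 a b} {F : ℝ → ℂ} (c : ℂ) (hf : IsContRep f F) :
    IsContRep (c • f) (c • F) :=
  ⟨hf.1.const_smul c, (Lp.coeFn_smul c f).trans (hf.2.const_smul c)⟩

/-! ### The chain of `N = n + 1` intervals `(j, j+1)`, `j = 0, …, n` -/

/-- The Hilbert space `∏_{j=0}^{n} L²(j,j+1)` with `⟨u, v⟩ = ∑_j ⟨u_j, v_j⟩`. -/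
abbrev ChainL2 (n : ℕ) : Type :=
  PiLp 2 fun j : Fin (n + 1) => L2 ((j : ℕ) : ℝ) ((j : ℕ) + 1)

/-- The boundary and transmission conditions for the values `U j` and first derivatives `V j` on
the intervals `[j, j+1]`. -/
structure VertexConditions {n : ℕ} (ρ : Fin (n + 1) → ℝ) (U V : Fin (n + 1) → ℝ → ℂ) : Prop where
  damping : (ρ 0 : ℂ) * V 0 0 = Complex.I * U 0 0
  dirichlet : U (Fin.last n) ((n : ℝ) + 1) = 0
  continuity : ∀ j : Fin n,
    U j.castSucc (((j : ℕ) : ℝ) + 1) = U j.succ (((j : ℕ) : ℝ) + 1)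
  kirchhoff : ∀ j : Fin n,
    -((ρ j.castSucc : ℂ) * V j.castSucc (((j : ℕ) : ℝ) + 1))
      + (ρ j.succ : ℂ) * V j.succ (((j : ℕ) : ℝ) + 1) = 0

/-- `u ∈ ∏_j H²(j,j+1)` with weak derivatives `u'_j = v_j` and `u''_j = w_j` in `L²(j,j+1)`,
satisfying the vertex conditions. -/
def InDomain {n : ℕ} (ρ : Fin (n + 1) → ℝ) (u w : ChainL2 n) : Prop :=
  ∃ v : ChainL2 n, (∀ j, IsWeakDeriv (u j) (v j)) ∧ (∀ j, IsWeakDeriv (v j) (w j)) ∧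
    ∃ U V : Fin (n + 1) → ℝ → ℂ, (∀ j, IsContRep (u j) (U j)) ∧ (∀ j, IsContRep (v j) (V j)) ∧
      VertexConditions ρ U V

lemma InDomain.zero {n : ℕ} (ρ : Fin (n + 1) → ℝ) : InDomain ρ 0 0 :=
  ⟨0, fun _ => IsWeakDeriv.zero, fun _ => IsWeakDeriv.zero, 0, 0, fun _ => IsContRep.zero,
    fun _ => IsContRep.zero, by constructor <;> simp⟩

lemma InDomain.add {n : ℕ} {ρ : Fin (n + 1) → ℝ} {u w u' w' : ChainL2 n} (h : InDomain ρ u w)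
    (h' : InDomain ρ u' w') : InDomain ρ (u + u') (w + w') := by
  obtain ⟨v, h₁, h₂, U, V, h₃, h₄, h₅⟩ := h
  obtain ⟨v', h₁', h₂', U', V', h₃', h₄', h₅'⟩ := h'
  refine ⟨v + v', fun j => (h₁ j).add (h₁' j), fun j => (h₂ j).add (h₂' j), U + U', V + V',
    fun j => (h₃ j).add (h₃' j), fun j => (h₄ j).add (h₄' j), ?_, ?_, ?_, ?_⟩
  · simp only [Pi.add_apply]
    linear_combination h₅.damping + h₅'.damping
  · simp only [Pi.add_apply]
    linear_combination h₅.dirichlet + h₅'.dirichlet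
  · intro j
    simp only [Pi.add_apply]
    linear_combination h₅.continuity j + h₅'.continuity j
  · intro j
    simp only [Pi.add_apply]
    linear_combination h₅.kirchhoff j + h₅'.kirchhoff j

lemma InDomain.smul {n : ℕ} {ρ : Fin (n + 1) → ℝ} {u w : ChainL2 n} (c : ℂ)
    (h : InDomain ρ u w) : InDomain ρ (c • u) (c • w) := by
  obtain ⟨v, h₁, h₂, U, V, h₃, h₄, h₅⟩ := h
  refine ⟨c • v, fun j => (h₁ j).smul c, fun j => (h₂ j).smul c, c • U, c • V,
    fun j => (h₃ j).smul c, fun j => (h₄ j).smul c, ?_, ?_, ?_, ?_⟩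
  · simp only [Pi.smul_apply, smul_eq_mul]
    linear_combination c * h₅.damping
  · simp only [Pi.smul_apply, smul_eq_mul]
    linear_combination c * h₅.dirichlet
  · intro j
    simp only [Pi.smul_apply, smul_eq_mul]
    linear_combination c * h₅.continuity j
  · intro j
    simp only [Pi.smul_apply, smul_eq_mul]
    linear_combination c * h₅.kirchhoff j

lemma InDomain.unique {n : ℕ} {ρ : Fin (n + 1) → ℝ} {u w w' : ChainL2 n} (h : InDomain ρ u w)
    (h' : InDomain ρ u w') : w = w' := by
  obtain ⟨v, h₁, h₂, -⟩ := h
  obtain ⟨v', h₁', h₂', -⟩ := h'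
  ext1 j
  have e : v j = v' j := (h₁ j).unique (h₁' j)
  exact (h₂ j).unique (e ▸ h₂' j)

/-- The domain of the Schrödinger chain operator. -/
def chainDomain {n : ℕ} (ρ : Fin (n + 1) → ℝ) : Submodule ℂ (ChainL2 n) where
  carrier := {u | ∃ w, InDomain ρ u w}
  zero_mem' := ⟨0, InDomain.zero ρ⟩
  add_mem' := fun ⟨w, h⟩ ⟨w', h'⟩ => ⟨w + w', h.add h'⟩
  smul_mem' := fun c _ ⟨w, h⟩ => ⟨c • w, h.smul c⟩

/-- The second weak derivative `(u''_j)_j` on the domain. -/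
def secondDeriv {n : ℕ} (ρ : Fin (n + 1) → ℝ) : chainDomain ρ →ₗ[ℂ] ChainL2 n where
  toFun u := u.2.choose
  map_add' u v :=
    InDomain.unique (u + v).2.choose_spec (u.2.choose_spec.add v.2.choose_spec)
  map_smul' c u := InDomain.unique (c • u).2.choose_spec (u.2.choose_spec.smul c)

/-- Multiplication of the `j`-th component by `-i ρ_j`. -/
def coefficient {n : ℕ} (ρ : Fin (n + 1) → ℝ) : ChainL2 n →ₗ[ℂ] ChainL2 n where
  toFun w := WithLp.toLp 2 fun j => (-(Complex.I * (ρ j : ℂ))) • w j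
  map_add' w w' := by ext1 j; simp
  map_smul' c w := by ext1 j; simp [smul_comm c]

/-- The operator `A u = (-i ρ_j u''_j)_j` in `∏_j L²(j,j+1)`. -/
def chainOperator {n : ℕ} (ρ : Fin (n + 1) → ℝ) : ChainL2 n →ₗ.[ℂ] ChainL2 n where
  domain := chainDomain ρ
  toFun := coefficient ρ ∘ₗ secondDeriv ρ

/-- The energy `E = (1/2) ∑_j ∫_j^{j+1} |u_j(x)|² dx`. -/
def energy {n : ℕ} (u : ChainL2 n) : ℝ :=
  (1 / 2) * ∑ j : Fin (n + 1), ∫ x in Ioo ((j : ℕ) : ℝ) ((j : ℕ) + 1), ‖u j x‖ ^ 2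

end SchrodingerChain

end

noncomputable section

namespace SchrodingerChain

open Filter Topology

/-! ### m-dissipative operators on a complex Hilbert space -/

section Dissipative

variable {E : Type*} [NormedAddCommGroup E] [InnerProductSpace ℂ E]

/-! The energy is half the squared norm, so everything rests on two facts about `A`. Integrating by
parts on each interval, the transmission conditions cancel the interior boundary terms and the
damping condition leaves `Re ⟨A u, u⟩ = -|u_0(0)|²` (`re_inner_chainOperator`). Moreover `A u = f`
can be solved by integrating twice along the whole chain, with a single free constant fixed by the
Dirichlet condition (`chainOperator_surjective`).

A dissipative operator that is onto has a bounded inverse, and a coercivity argument makes `l I - A`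
onto for all `l > 0` (`isMDissipative_of_surjective`). The rest is Hille–Yosida theory: exponentials
of the bounded Yosida approximations are contractions converging locally uniformly to a mild
solution (`exists_mildSolution`). Uniqueness holds because the difference of the integrals of two
solutions solves `w' = A w`, `w(0) = 0`. Data in the domain give classical solutions, obtained by
integrating the mild solution that starts at `A u₀`.

Weak derivatives enter only through `IsWeakDeriv.isPrimitive` and `isWeakDeriv_of_isPrimitive`,
which turn them into integral formulas for continuous representatives. -/

lemma hasDerivWithinAt_norm_sq {u : ℝ → E} {u' : E} {s : Set ℝ} {t : ℝ}
    (h : HasDerivWithinAt u u' s t) :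
    HasDerivWithinAt (fun r => ‖u r‖ ^ 2) (2 * (inner ℂ u' (u t)).re) s t := by
  have h₁ := Complex.reCLM.hasFDerivAt.comp_hasDerivWithinAt t (h.inner ℂ h)
  refine (h₁.congr_deriv ?_).congr_of_eventuallyEq
    (Eventually.of_forall fun r => ?_) ?_
  · have := inner_re_symm (𝕜 := ℂ) (u t) u'
    simp only [RCLike.re_to_complex] at this
    simp only [Complex.reCLM_apply, Complex.add_re, this]
    ring
  all_goals exact (inner_self_eq_norm_sq (𝕜 := ℂ) _).symm

lemma antitoneOn_norm_of_dissipative {u u' : ℝ → E}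
    (h : ∀ t, 0 ≤ t → HasDerivWithinAt u (u' t) (Ici 0) t)
    (hd : ∀ t, 0 ≤ t → (inner ℂ (u' t) (u t)).re ≤ 0) :
    AntitoneOn (fun t => ‖u t‖) (Ici 0) := by
  have key : AntitoneOn (fun t => ‖u t‖ ^ 2) (Ici 0) := by
    refine antitoneOn_of_hasDerivWithinAt_nonpos (convex_Ici 0)
      (fun t ht => (hasDerivWithinAt_norm_sq (h t ht)).continuousWithinAt)
      (f' := fun t => 2 * (inner ℂ (u' t) (u t)).re) (fun t ht => ?_) fun t ht => ?_
    · rw [interior_Ici] at ht ⊢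
      exact (hasDerivWithinAt_norm_sq (h t (le_of_lt ht))).mono Ioi_subset_Ici_self
    · rw [interior_Ici] at ht
      have := hd t (le_of_lt ht)
      linarith
  intro s hs t ht hst
  exact (sq_le_sq₀ (norm_nonneg _) (norm_nonneg _)).1 (key hs ht hst)

lemma hasDerivWithinAt_integral_Ici {F : Type*} [NormedAddCommGroup F] [NormedSpace ℝ F]
    [CompleteSpace F] {u : ℝ → F} (hu : ContinuousOn u (Ici 0)) {t : ℝ} (ht : 0 ≤ t) :
    HasDerivWithinAt (fun r => ∫ s in (0 : ℝ)..r, u s) (u t) (Ici 0) t := by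
  -- Freezing `u` at its value at `0` extends it continuously to the line, so the two-sided
  -- fundamental theorem applies even at `t = 0`.
  have hc : Continuous fun s => u (max 0 s) :=
    hu.comp_continuous (by fun_prop) fun s => le_max_left 0 s
  have h := (intervalIntegral.integral_hasDerivAt_right (hc.intervalIntegrable 0 t)
    (hc.stronglyMeasurableAtFilter _ _) hc.continuousAt).hasDerivWithinAt (s := Ici (0 : ℝ))
  simp only [max_eq_right ht] at h
  have e : ∀ r ∈ Ici (0 : ℝ), ∫ s in (0 : ℝ)..r, u s = ∫ s in (0 : ℝ)..r, u (max 0 s) := by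
    intro r hr
    refine intervalIntegral.integral_congr fun s hs => ?_
    rw [uIcc_of_le hr] at hs
    simp only [max_eq_right hs.1]
  exact h.congr e (e t ht)

lemma intervalIntegrable_of_continuousOn_Ici {F : Type*} [NormedAddCommGroup F] {u : ℝ → F}
    (hu : ContinuousOn u (Ici 0)) {s t : ℝ} (hs : 0 ≤ s) (ht : 0 ≤ t) :
    IntervalIntegrable u volume s t :=
  (hu.mono fun _ hr => (le_min hs ht).trans hr.1).intervalIntegrable

/-- `R = (l I - A)⁻¹` as a bounded operator with `‖R‖ ≤ 1 / l`. -/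
structure IsResolvent (A : E →ₗ.[ℂ] E) (l : ℝ) (R : E →L[ℂ] E) : Prop where
  mem : ∀ f, R f ∈ A.domain
  right_inv : ∀ f, (l : ℂ) • R f - A ⟨R f, mem f⟩ = f
  left_inv : ∀ x : A.domain, R ((l : ℂ) • (x : E) - A x) = x
  norm_le : ∀ f, l * ‖R f‖ ≤ ‖f‖

variable {A : E →ₗ.[ℂ] E}

/-- Pairing with `x` gives `l ‖x‖² ≤ Re ⟨(l - A) x, x⟩`; then Cauchy–Schwarz. -/
lemma IsMDissipative.norm_le (hA : IsMDissipative A) (l : ℝ) (x : A.domain) :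
    l * ‖(x : E)‖ ≤ ‖(l : ℂ) • (x : E) - A x‖ := by
  rcases eq_or_ne (x : E) 0 with h | h
  · simp [h]
  have h₁ : (inner ℂ ((l : ℂ) • (x : E) - A x) (x : E)).re
      = l * ‖(x : E)‖ ^ 2 - (inner ℂ (A x) (x : E)).re := by
    rw [inner_sub_left, inner_smul_left, Complex.sub_re, inner_self_eq_norm_sq_to_K]
    simp [← Complex.ofReal_pow, ← Complex.ofReal_mul]
  have h₂ := hA.dissipative x
  have h₃ := (Complex.re_le_norm _).trans (norm_inner_le_norm (𝕜 := ℂ)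
    ((l : ℂ) • (x : E) - A x) (x : E))
  have h₄ : 0 < ‖(x : E)‖ := norm_pos_iff.2 h
  nlinarith

lemma IsMDissipative.injective (hA : IsMDissipative A) {l : ℝ} (hl : 0 < l) {x y : A.domain}
    (h : (l : ℂ) • (x : E) - A x = (l : ℂ) • (y : E) - A y) : x = y := by
  have h₁ := hA.norm_le l (x - y)
  have h₂ : (l : ℂ) • ((x - y : A.domain) : E) - A (x - y) = 0 := by
    rw [A.map_sub, Submodule.coe_sub, smul_sub, ← sub_eq_zero.2 h]
    abel
  rw [h₂, norm_zero] at h₁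
  have h₃ : ‖((x - y : A.domain) : E)‖ = 0 :=
    le_antisymm (by nlinarith [norm_nonneg ((x - y : A.domain) : E)]) (norm_nonneg _)
  exact sub_eq_zero.1 (Subtype.ext (norm_eq_zero.1 h₃))

lemma IsMDissipative.exists_resolvent (hA : IsMDissipative A) {l : ℝ} (hl : 0 < l) :
    ∃ R : E →L[ℂ] E, IsResolvent A l R := by
  choose r hr using hA.maximal l hl
  have hadd : ∀ f g, r (f + g) = r f + r g := fun f g => hA.injective hl (by
    rw [hr, A.map_add, Submodule.coe_add, smul_add, add_sub_add_comm, hr, hr])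
  have hsmul : ∀ (c : ℂ) f, r (c • f) = c • r f := fun c f => hA.injective hl (by
    rw [hr, A.map_smul, Submodule.coe_smul, smul_comm, ← smul_sub, hr])
  have hn : ∀ f, l * ‖(r f : E)‖ ≤ ‖f‖ := fun f => by
    simpa only [hr] using hA.norm_le l (r f)
  let R₀ : E →ₗ[ℂ] E :=
    { toFun := fun f => r f
      map_add' := fun f g => by rw [hadd]; rfl
      map_smul' := fun c f => by rw [hsmul]; rfl }
  let R : E →L[ℂ] E := R₀.mkContinuous l⁻¹ fun f => by
    rw [inv_mul_eq_div, le_div_iff₀ hl, mul_comm]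
    exact hn f
  exact ⟨R, fun f => (r f).2, fun f => hr f,
    fun x => congrArg Subtype.val (hA.injective hl (hr _)), hn⟩

namespace IsResolvent

variable {l m : ℝ} {R S : E →L[ℂ] E}

/-- Serves as the closedness of `A`: a statement about the unbounded `A` becomes the identity `x = R
g` for a bounded operator, which survives limits and integration. -/
lemma mem_of_eq (hR : IsResolvent A l R) {x g : E} (h : x = R g) :
    ∃ hx : x ∈ A.domain, A ⟨x, hx⟩ = (l : ℂ) • x - g := by
  subst h
  refine ⟨hR.mem g, ?_⟩
  conv_rhs => rw [← hR.right_inv g]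
  have : R ((l : ℂ) • R g - A ⟨R g, hR.mem g⟩) = R g := by rw [hR.right_inv g]
  rw [this]
  abel

lemma apply_map (hR : IsResolvent A l R) (x : A.domain) : R (A x) = (l : ℂ) • R x - x := by
  have := hR.left_inv x
  rw [map_sub, map_smul] at this
  rw [eq_sub_iff_add_eq, ← sub_eq_iff_eq_add'.1 this]

lemma resolvent_identity (hR : IsResolvent A l R) (hS : IsResolvent A m S) (f : E) :
    R f = S f + ((m : ℂ) - l) • R (S f) := by
  have h₁ := hS.right_inv f
  have h₂ := hR.left_inv ⟨S f, hS.mem f⟩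
  have h₃ := congrArg R h₁
  rw [map_sub, map_smul] at h₂ h₃
  rw [← h₃, sub_smul, sub_eq_iff_eq_add.1 h₂]
  abel

/-- Adding the resolvent identity to the one with `R` and `S` exchanged gives `(m - l) (R S - S R) =
0`; for `m = l` the identity itself gives `R = S`. -/
lemma commute (hR : IsResolvent A l R) (hS : IsResolvent A m S) : Commute R S := by
  ext f
  change R (S f) = S (R f)
  rcases eq_or_ne (m : ℂ) l with h | h
  · have e : R = S := by
      ext g
      simpa [h] using hR.resolvent_identity hS g
    rw [e]
  · have h₁ := hR.resolvent_identity hS f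
    have h₂ := hS.resolvent_identity hR f
    have h₃ : ((m : ℂ) - l) • (R (S f) - S (R f)) = 0 := by
      rw [smul_sub, ← sub_eq_iff_eq_add'.2 h₁, ← neg_sub (l : ℂ) m, neg_smul,
        ← sub_eq_iff_eq_add'.2 h₂]
      abel
    exact sub_eq_zero.1 ((smul_eq_zero.1 h₃).resolve_left (sub_ne_zero.2 h))

end IsResolvent

/-- Write a vector `h` orthogonal to the domain as `x - A x`. Pairing with `x` gives `0 = ‖x‖² - Re
⟨A x, x⟩ ≥ ‖x‖²`, so `x = 0` and `h = 0`. -/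
lemma IsMDissipative.dense_domain [CompleteSpace E] (hA : IsMDissipative A) :
    Dense (A.domain : Set E) := by
  rw [Submodule.dense_iff_topologicalClosure_eq_top, Submodule.topologicalClosure_eq_top_iff,
    Submodule.eq_bot_iff]
  intro h hh
  obtain ⟨x, hx⟩ := hA.maximal 1 one_pos h
  have h₀ : inner ℂ h (x : E) = 0 := Submodule.inner_left_of_mem_orthogonal x.2 hh
  have h₁ : (inner ℂ ((1 : ℝ) • (x : E) - A x) (x : E)).re
      = ‖(x : E)‖ ^ 2 - (inner ℂ (A x) (x : E)).re := by
    rw [one_smul, inner_sub_left, Complex.sub_re, inner_self_eq_norm_sq_to_K]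
    simp [← Complex.ofReal_pow]
  have h₂ := hA.dissipative x
  rw [Complex.ofReal_one, one_smul] at hx
  rw [one_smul, hx, h₀, Complex.zero_re] at h₁
  have h₃ : (x : E) = 0 := by
    rw [← norm_eq_zero, ← sq_eq_zero_iff]
    exact le_antisymm (by linarith) (sq_nonneg _)
  have h₄ : x = 0 := Subtype.ext h₃
  rw [← hx, h₄]
  simp

end Dissipative

/-! ### Existence of mild solutions by Yosida approximation -/

section Generation

variable {E : Type*} [NormedAddCommGroup E] [InnerProductSpace ℂ E]

lemma hasDerivAt_exp_smul_apply [CompleteSpace E] (B : E →L[ℂ] E) (x : E) (t : ℝ) :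
    HasDerivAt (fun t : ℝ => NormedSpace.exp (t • B) x) (B (NormedSpace.exp (t • B) x)) t :=
  (((ContinuousLinearMap.apply ℂ E x).restrictScalars ℝ).hasFDerivAt.comp_hasDerivAt t
    (hasDerivAt_exp_smul_const' (𝕂 := ℝ) B t))

lemma norm_exp_smul_apply_le [CompleteSpace E] {B : E →L[ℂ] E} (hB : ∀ x, (inner ℂ (B x) x).re ≤ 0) (x : E)
    {t : ℝ} (ht : 0 ≤ t) : ‖NormedSpace.exp (t • B) x‖ ≤ ‖x‖ := by
  have h := antitoneOn_norm_of_dissipative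
    (fun t _ => (hasDerivAt_exp_smul_apply B x t).hasDerivWithinAt) (fun t _ => hB _)
    (mem_Ici.2 le_rfl) ht ht
  simpa using h

/-- The path `s ↦ exp ((t - s) C) exp (s B) x` joins the two exponentials. By commutation its
derivative is the same product of contractions applied to `B x - C x`. -/
lemma norm_exp_smul_sub_le [CompleteSpace E] {B C : E →L[ℂ] E} (hB : ∀ x, (inner ℂ (B x) x).re ≤ 0)
    (hC : ∀ x, (inner ℂ (C x) x).re ≤ 0) (hBC : Commute B C) (x : E) {t : ℝ} (ht : 0 ≤ t) :
    ‖NormedSpace.exp (t • B) x - NormedSpace.exp (t • C) x‖ ≤ t * ‖B x - C x‖ := by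
  have hd : ∀ s : ℝ, HasDerivAt
      (fun s : ℝ => (NormedSpace.exp ((t - s) • C) * NormedSpace.exp (s • B)) x)
      ((NormedSpace.exp ((t - s) • C) * NormedSpace.exp (s • B)) (B x - C x)) s := by
    intro s
    have h₁ := (hasDerivAt_exp_smul_const (𝕂 := ℝ) C (t - s)).scomp s
      ((hasDerivAt_id s).const_sub t)
    have h₂ := h₁.mul (hasDerivAt_exp_smul_const (𝕂 := ℝ) B s)
    refine ((((ContinuousLinearMap.apply ℂ E x).restrictScalars ℝ).hasFDerivAt.comp_hasDerivAt s
      h₂).congr_deriv ?_)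
    have hc : Commute C (NormedSpace.exp (s • B)) :=
      (Commute.smul_right hBC.symm s).exp_right
    have e : -1 • (NormedSpace.exp ((t - s) • C) * C) * NormedSpace.exp (s • B)
        + NormedSpace.exp ((t - s) • C) * (NormedSpace.exp (s • B) * B)
        = NormedSpace.exp ((t - s) • C) * NormedSpace.exp (s • B) * (B - C) := by
      rw [neg_smul, one_smul, neg_mul, mul_assoc, hc.eq]
      noncomm_ring
    simpa using congrArg (fun T : E →L[ℂ] E => T x) e
  have h := norm_image_sub_le_of_norm_deriv_le_segment'
    (f := fun s : ℝ => (NormedSpace.exp ((t - s) • C) * NormedSpace.exp (s • B)) x)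
    (a := 0) (b := t) (C := ‖B x - C x‖) (fun s _ => (hd s).hasDerivWithinAt)
    (fun s hs => (norm_exp_smul_apply_le hC _ (sub_nonneg.2 hs.2.le)).trans
      (norm_exp_smul_apply_le hB _ hs.1)) t (right_mem_Icc.2 ht)
  simpa [mul_comm] using h

variable {A : E →ₗ.[ℂ] E}

/-- The Yosida approximation `l A (l I - A)⁻¹ = l² (l I - A)⁻¹ - l I`. -/
def yosida (l : ℝ) (R : E →L[ℂ] E) : E →L[ℂ] E :=
  (l : ℂ) • ((l : ℂ) • R - 1)

namespace IsResolvent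

variable {l m : ℝ} {R S : E →L[ℂ] E}

lemma yosida_apply (hR : IsResolvent A l R) (f : E) :
    yosida l R f = (l : ℂ) • A ⟨R f, hR.mem f⟩ := by
  have h : (l : ℂ) • R f - f = A ⟨R f, hR.mem f⟩ :=
    (sub_eq_iff_eq_add'.2 (sub_eq_iff_eq_add.1 (hR.right_inv f)))
  rw [← h]
  rfl

lemma yosida_domain (hR : IsResolvent A l R) (x : A.domain) :
    yosida l R x = (l : ℂ) • R (A x) := by
  rw [hR.apply_map]
  simp [yosida]

lemma yosida_commute (hR : IsResolvent A l R) (hS : IsResolvent A m S) :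
    Commute (yosida l R) (yosida m S) := by
  have h : Commute ((l : ℂ) • R - 1) ((m : ℂ) • S - 1) :=
    ((((hR.commute hS).smul_left _).smul_right _).sub_left (Commute.one_left _)).sub_right
      (Commute.one_right _)
  exact (h.smul_left _).smul_right _

/-- With `y = A R f` one has `f = l R f - y`, and pairing `l y` with this gives `l² Re ⟨y, R f⟩ - l
‖y‖²`. -/
lemma yosida_dissipative (hA : IsMDissipative A) (hl : 0 ≤ l) (hR : IsResolvent A l R) (f : E) :
    (inner ℂ (yosida l R f) f).re ≤ 0 := by
  rw [hR.yosida_apply]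
  have h₁ := hA.dissipative ⟨R f, hR.mem f⟩
  have h₂ := hR.right_inv f
  set y := A ⟨R f, hR.mem f⟩
  have h₃ : (inner ℂ ((l : ℂ) • y) ((l : ℂ) • R f - y)).re
      = l ^ 2 * (inner ℂ y (R f)).re - l * ‖y‖ ^ 2 := by
    rw [inner_sub_right, inner_smul_left, inner_smul_left, inner_smul_right, Complex.sub_re,
      inner_self_eq_norm_sq_to_K]
    simp [← Complex.ofReal_pow, ← Complex.ofReal_mul]
    ring
  rw [h₂] at h₃
  rw [h₃]
  nlinarith [mul_nonneg hl (sq_nonneg ‖y‖), sq_nonneg l]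

end IsResolvent

variable [CompleteSpace E]

/-- On the domain `l R x - x = R (A x)` is of size at most `‖A x‖ / l`; density and `‖l R‖ ≤ 1` give
the general case. -/
lemma IsMDissipative.tendsto_smul_resolvent (hA : IsMDissipative A) {R : ℕ → E →L[ℂ] E}
    (hR : ∀ n : ℕ, IsResolvent A (n + 1 : ℝ) (R n)) (f : E) :
    Tendsto (fun n : ℕ => (((n : ℝ) + 1 : ℝ) : ℂ) • R n f) atTop (𝓝 f) := by
  rw [Metric.tendsto_atTop]
  intro ε hε
  obtain ⟨x, hx, hxf⟩ := Metric.dense_iff.1 hA.dense_domain f (ε / 3) (by positivity)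
  rw [Metric.mem_ball, dist_eq_norm] at hx
  obtain ⟨n₀, hn₀⟩ := exists_nat_gt (‖A ⟨x, hxf⟩‖ / (ε / 3))
  refine ⟨n₀, fun n hn => ?_⟩
  have hn' : (n₀ : ℝ) ≤ n := by exact_mod_cast hn
  have hpos : (0 : ℝ) < n + 1 := by positivity
  have h₁ : ‖(((n : ℝ) + 1 : ℝ) : ℂ) • R n (f - x)‖ ≤ ‖f - x‖ := by
    rw [norm_smul, Complex.norm_real, Real.norm_of_nonneg hpos.le]
    exact (hR n).norm_le _
  have h₂ : (((n : ℝ) + 1 : ℝ) : ℂ) • R n x - x = R n (A ⟨x, hxf⟩) :=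
    ((hR n).apply_map ⟨x, hxf⟩).symm
  have h₃ : ‖R n (A ⟨x, hxf⟩)‖ < ε / 3 := by
    rw [div_lt_iff₀ (by positivity)] at hn₀
    have := (hR n).norm_le (A ⟨x, hxf⟩)
    by_contra! hc
    nlinarith
  rw [dist_eq_norm]
  calc ‖(((n : ℝ) + 1 : ℝ) : ℂ) • R n f - f‖
      = ‖(((n : ℝ) + 1 : ℝ) : ℂ) • R n (f - x) + R n (A ⟨x, hxf⟩) + (x - f)‖ := by
        rw [← h₂, map_sub, smul_sub]
        congr 1
        abel
    _ ≤ ‖(((n : ℝ) + 1 : ℝ) : ℂ) • R n (f - x)‖ + ‖R n (A ⟨x, hxf⟩)‖ + ‖x - f‖ :=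
        norm_add₃_le
    _ < ε := by rw [norm_sub_rev] at h₁; linarith

lemma IsMDissipative.exists_tendsto_exp_yosida (hA : IsMDissipative A) {R : ℕ → E →L[ℂ] E}
    (hR : ∀ n : ℕ, IsResolvent A (n + 1 : ℝ) (R n)) (f : E) :
    ∃ u : ℝ → E, ∀ T : ℝ, TendstoUniformlyOn
      (fun (n : ℕ) (t : ℝ) => NormedSpace.exp (t • yosida (n + 1 : ℝ) (R n)) f)
      u atTop (Icc 0 T) := by
  set v : ℕ → ℝ → E → E := fun n t f => NormedSpace.exp (t • yosida (n + 1 : ℝ) (R n)) f with hv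
  have hd : ∀ (n : ℕ) x, (inner ℂ (yosida (n + 1 : ℝ) (R n) x) x).re ≤ 0 := fun n x =>
    (hR n).yosida_dissipative hA (by positivity) x
  have hc : ∀ T : ℝ, UniformCauchySeqOn (fun n t => v n t f) atTop (Icc 0 T) := by
    intro T
    rw [Metric.uniformCauchySeqOn_iff]
    intro ε hε
    -- The budget is `ε / 4` for each of the two contractions applied to `f - x`, and `ε / 4` for
    -- the difference of the approximations at `x` over times up to `|T|`.
    obtain ⟨x, hx, hxf⟩ := Metric.dense_iff.1 hA.dense_domain f (ε / 4) (by positivity)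
    rw [Metric.mem_ball, dist_eq_norm, norm_sub_rev] at hx
    have hy : CauchySeq fun n : ℕ => yosida (n + 1 : ℝ) (R n) x := by
      exact ((hA.tendsto_smul_resolvent hR (A ⟨x, hxf⟩)).congr fun n =>
        ((hR n).yosida_domain ⟨x, hxf⟩).symm).cauchySeq
    obtain ⟨n₀, hn₀⟩ := Metric.cauchySeq_iff.1 hy (ε / (4 * (|T| + 1))) (by positivity)
    refine ⟨n₀, fun m hm n hn t ht => ?_⟩
    have h₁ := hn₀ m hm n hn
    rw [dist_eq_norm, lt_div_iff₀ (by positivity)] at h₁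
    have h₂ := norm_exp_smul_sub_le (hd m) (hd n) ((hR m).yosida_commute (hR n)) x ht.1
    have h₃ := norm_exp_smul_apply_le (hd m) (f - x) ht.1
    have h₄ := norm_exp_smul_apply_le (hd n) (f - x) ht.1
    have h₅ : t ≤ |T| := ht.2.trans (le_abs_self T)
    have h₆ : v m t f - v n t f = v m t (f - x) - v n t (f - x) + (v m t x - v n t x) := by
      simp only [hv, map_sub]
      abel
    rw [dist_eq_norm, h₆]
    have h₇ := norm_add_le (v m t (f - x) - v n t (f - x)) (v m t x - v n t x)
    have h₈ := norm_sub_le (v m t (f - x)) (v n t (f - x))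
    simp only [hv] at h₇ h₈ ⊢
    nlinarith [norm_nonneg (yosida (m + 1 : ℝ) (R m) x - yosida (n + 1 : ℝ) (R n) x)]
  choose! u hu using fun (t : ℝ) (ht : 0 ≤ t) =>
    cauchySeq_tendsto_of_complete ((hc t).cauchy_map (right_mem_Icc.2 ht))
  exact ⟨u, fun T => (hc T).tendstoUniformlyOn_of_tendsto fun t ht => hu t ht.1⟩

theorem IsMDissipative.exists_mildSolution (hA : IsMDissipative A) (f : E) :
    ∃ u : ℝ → E, IsMildSolution A f u ∧ ∀ t, 0 ≤ t → ‖u t‖ ≤ ‖f‖ := by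
  choose R hR using fun n : ℕ => hA.exists_resolvent (l := n + 1) (by positivity)
  obtain ⟨u, hu⟩ := hA.exists_tendsto_exp_yosida hR f
  set v : ℕ → ℝ → E := fun n t => NormedSpace.exp (t • yosida (n + 1 : ℝ) (R n)) f with hv
  have hd : ∀ (n : ℕ) x, (inner ℂ (yosida (n + 1 : ℝ) (R n) x) x).re ≤ 0 := fun n x =>
    (hR n).yosida_dissipative hA (by positivity) x
  have hvd : ∀ n t, HasDerivAt (v n) (yosida (n + 1 : ℝ) (R n) (v n t)) t := fun n t =>
    hasDerivAt_exp_smul_apply _ _ _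
  have hvc : ∀ n, Continuous (v n) := fun n =>
    continuous_iff_continuousAt.2 fun t => (hvd n t).continuousAt
  have hvb : ∀ n t, 0 ≤ t → ‖v n t‖ ≤ ‖f‖ := fun n t ht => norm_exp_smul_apply_le (hd n) f ht
  have hlim : ∀ t, 0 ≤ t → Tendsto (fun n => v n t) atTop (𝓝 (u t)) := fun t ht =>
    (hu t).tendsto_at (right_mem_Icc.2 ht)
  have huc : ContinuousOn u (Ici 0) := by
    intro t ht
    have h : ContinuousOn u (Icc 0 (t + 1)) :=
      (hu (t + 1)).continuousOn (Frequently.of_forall fun n => (hvc n).continuousOn)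
    refine (h t ⟨ht, by linarith⟩).mono_of_mem_nhdsWithin ?_
    rw [← Ici_inter_Iic]
    exact inter_mem self_mem_nhdsWithin (mem_nhdsWithin_of_mem_nhds (Iic_mem_nhds (by linarith)))
  refine ⟨u, ⟨huc, fun t ht => ?_⟩, fun t ht => le_of_tendsto (hlim t ht).norm
    (Eventually.of_forall fun n => hvb n t ht)⟩
  have hint : Tendsto (fun n => ∫ s in (0 : ℝ)..t, v n s) atTop
      (𝓝 (∫ s in (0 : ℝ)..t, u s)) := by
    refine intervalIntegral.tendsto_integral_filter_of_dominated_convergence (fun _ => ‖f‖)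
      (Eventually.of_forall fun n => (hvc n).aestronglyMeasurable)
      (Eventually.of_forall fun n => ae_of_all _ fun s hs => ?_) (by simp)
      (ae_of_all _ fun s hs => ?_)
    · rw [uIoc_of_le ht] at hs
      exact hvb n s hs.1.le
    · rw [uIoc_of_le ht] at hs
      exact hlim s hs.1.le
  have hyos : ∀ n : ℕ, yosida (n + 1 : ℝ) (R n) (∫ s in (0 : ℝ)..t, v n s) = v n t - f := by
    intro n
    rw [← ContinuousLinearMap.intervalIntegral_comp_comm _ ((hvc n).intervalIntegrable 0 t),
      intervalIntegral.integral_eq_sub_of_hasDerivAt (fun s _ => hvd n s)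
        (((yosida (n + 1 : ℝ) (R n)).continuous.comp (hvc n)).intervalIntegrable 0 t)]
    simp [hv]
  -- The vectors `(n + 1) R n (∫ v n)` lie in the domain, and `A` maps them to `v n t - f`. Both
  -- they and their images converge, so closedness of `A` gives the mild equation.
  have hJ : Tendsto (fun n : ℕ => (((n : ℝ) + 1 : ℝ) : ℂ) • R n (∫ s in (0 : ℝ)..t, v n s)) atTop
      (𝓝 (∫ s in (0 : ℝ)..t, u s)) := by
    have h₁ := hA.tendsto_smul_resolvent hR (∫ s in (0 : ℝ)..t, u s)
    have h₂ : Tendsto (fun n : ℕ => (((n : ℝ) + 1 : ℝ) : ℂ) •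
        R n ((∫ s in (0 : ℝ)..t, v n s) - ∫ s in (0 : ℝ)..t, u s)) atTop (𝓝 0) := by
      refine squeeze_zero_norm (fun n => ?_) (tendsto_iff_norm_sub_tendsto_zero.1 hint)
      rw [norm_smul, Complex.norm_real, Real.norm_of_nonneg (by positivity)]
      exact (hR n).norm_le _
    have h₃ := h₂.add h₁
    rw [zero_add] at h₃
    refine h₃.congr fun n => ?_
    rw [map_sub, smul_sub, sub_add_cancel]
  have hR0 : IsResolvent A 1 (R 0) := by simpa using hR 0
  -- Closedness is applied through the fixed resolvent `R 0 = (I - A)⁻¹`, which does not vary with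
  -- `n`.
  have hfix : ∀ n : ℕ, (((n : ℝ) + 1 : ℝ) : ℂ) • R n (∫ s in (0 : ℝ)..t, v n s)
      = R 0 ((((n : ℝ) + 1 : ℝ) : ℂ) • R n (∫ s in (0 : ℝ)..t, v n s) - (v n t - f)) := by
    intro n
    have h₁ := (hR n).yosida_apply (∫ s in (0 : ℝ)..t, v n s)
    rw [hyos n] at h₁
    have h₂ := hR0.left_inv ((((n : ℝ) + 1 : ℝ) : ℂ) •
      ⟨R n (∫ s in (0 : ℝ)..t, v n s), (hR n).mem _⟩)
    rw [A.map_smul, ← h₁] at h₂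
    simpa using h₂.symm
  have hlimfix : (∫ s in (0 : ℝ)..t, u s) = R 0 ((∫ s in (0 : ℝ)..t, u s) - (u t - f)) :=
    tendsto_nhds_unique hJ ((((R 0).continuous.tendsto _).comp
      (hJ.sub ((hlim t ht).sub_const f))).congr fun n => (hfix n).symm)
  obtain ⟨hx, hAx⟩ := hR0.mem_of_eq hlimfix
  refine ⟨hx, ?_⟩
  rw [hAx]
  simp

end Generation

/-! ### Uniqueness, monotonicity of the norm and regularity of solutions -/

section Cauchy

variable {E : Type*} [NormedAddCommGroup E] [InnerProductSpace ℂ E] [CompleteSpace E]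
  {A : E →ₗ.[ℂ] E} {u₀ : E} {u v : ℝ → E}

/-- The difference `w` of the two integrals is differentiable with `w' = u - v = A w` and `w 0 = 0`.
Its norm is nonincreasing, so `w = 0`, and then `u - v = A w = 0`. -/
theorem IsMildSolution.eqOn (hA : IsMDissipative A) (hu : IsMildSolution A u₀ u)
    (hv : IsMildSolution A u₀ v) : EqOn u v (Ici 0) := by
  have key : ∀ t, 0 ≤ t → ∃ h : (∫ s in (0 : ℝ)..t, u s) - (∫ s in (0 : ℝ)..t, v s) ∈ A.domain,
      u t - v t = A ⟨(∫ s in (0 : ℝ)..t, u s) - ∫ s in (0 : ℝ)..t, v s, h⟩ := by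
    intro t ht
    obtain ⟨h₁, e₁⟩ := hu.integrated t ht
    obtain ⟨h₂, e₂⟩ := hv.integrated t ht
    refine ⟨A.domain.sub_mem h₁ h₂, ?_⟩
    have h₃ := A.map_sub ⟨_, h₁⟩ ⟨_, h₂⟩
    rw [e₁, e₂, add_sub_add_left_eq_sub, ← h₃]
    rfl
  have hanti := antitoneOn_norm_of_dissipative
    (u := fun t => (∫ s in (0 : ℝ)..t, u s) - ∫ s in (0 : ℝ)..t, v s)
    (fun t ht => (hasDerivWithinAt_integral_Ici hu.continuousOn ht).sub
      (hasDerivWithinAt_integral_Ici hv.continuousOn ht))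
    (fun t ht => by
      obtain ⟨h, e⟩ := key t ht
      rw [e]
      exact hA.dissipative ⟨_, h⟩)
  intro t ht
  have h₀ := hanti (mem_Ici.2 le_rfl) ht ht
  simp only [intervalIntegral.integral_same, sub_self, norm_zero, norm_le_zero_iff] at h₀
  obtain ⟨h, e⟩ := key t ht
  have h₁ : (⟨_, h⟩ : A.domain) = 0 := Subtype.ext h₀
  rw [h₁, A.map_zero] at e
  exact sub_eq_zero.1 e

lemma IsMildSolution.norm_le (hA : IsMDissipative A) (hu : IsMildSolution A u₀ u) {t : ℝ}
    (ht : 0 ≤ t) : ‖u t‖ ≤ ‖u₀‖ := by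
  obtain ⟨v, hv, hn⟩ := hA.exists_mildSolution u₀
  rw [hu.eqOn hA hv ht]
  exact hn t ht

omit [CompleteSpace E] in
lemma IsMildSolution.shift (hu : IsMildSolution A u₀ u) {s : ℝ} (hs : 0 ≤ s) :
    IsMildSolution A (u s) (fun t => u (s + t)) := by
  refine ⟨hu.continuousOn.comp (by fun_prop) fun t ht => add_nonneg hs ht, fun t ht => ?_⟩
  have e : ∫ r in (0 : ℝ)..t, u (s + r)
      = (∫ r in (0 : ℝ)..(s + t), u r) - ∫ r in (0 : ℝ)..s, u r := by
    rw [intervalIntegral.integral_comp_add_left, add_zero]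
    exact (intervalIntegral.integral_interval_sub_left
      (intervalIntegrable_of_continuousOn_Ici hu.continuousOn le_rfl (add_nonneg hs ht))
      (intervalIntegrable_of_continuousOn_Ici hu.continuousOn le_rfl hs)).symm
  obtain ⟨h₁, e₁⟩ := hu.integrated (s + t) (add_nonneg hs ht)
  obtain ⟨h₂, e₂⟩ := hu.integrated s hs
  rw [e]
  refine ⟨A.domain.sub_mem h₁ h₂, ?_⟩
  have h₃ := A.map_sub ⟨_, h₁⟩ ⟨_, h₂⟩
  have h₄ : A ⟨_, A.domain.sub_mem h₁ h₂⟩ = A ⟨_, h₁⟩ - A ⟨_, h₂⟩ := h₃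
  rw [h₄, e₁, e₂]
  abel

theorem IsMildSolution.antitoneOn_norm (hA : IsMDissipative A) (hu : IsMildSolution A u₀ u) :
    AntitoneOn (fun t => ‖u t‖) (Ici 0) := by
  intro s hs t _ hst
  have h := (hu.shift hs).norm_le hA (sub_nonneg.2 hst)
  simpa using h

theorem IsClassicalSolution.isMildSolution (hA : IsMDissipative A)
    (hu : IsClassicalSolution A u₀ u) : IsMildSolution A u₀ u := by
  obtain ⟨R, hR⟩ := hA.exists_resolvent one_pos
  have hc : ContinuousOn u (Ici 0) := hu.contDiffOn.continuousOn
  have hdc : ContinuousOn (derivWithin u (Ici 0)) (Ici 0) :=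
    hu.contDiffOn.continuousOn_derivWithin (uniqueDiffOn_Ici 0) le_rfl
  have hd : ∀ t, ∀ ht : 0 ≤ t, derivWithin u (Ici 0) t = A ⟨u t, hu.mem_domain t ht⟩ :=
    fun t ht => (hu.equation t ht).derivWithin (uniqueDiffOn_Ici 0 t ht)
  refine ⟨hc, fun t ht => ?_⟩
  have hi := intervalIntegrable_of_continuousOn_Ici hc le_rfl ht
  have hdi := intervalIntegrable_of_continuousOn_Ici hdc le_rfl ht
  have hftc : ∫ s in (0 : ℝ)..t, derivWithin u (Ici 0) s = u t - u₀ := by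
    rw [intervalIntegral.integral_eq_sub_of_hasDeriv_right_of_le ht
      (hc.mono Icc_subset_Ici_self) (fun s hs => ?_) hdi, hu.initial]
    rw [hd s hs.1.le]
    exact (hu.equation s hs.1.le).mono fun r hr => hs.1.le.trans (le_of_lt hr)
  -- Pointwise `u = R (u - u')`; the bounded `R`, unlike `A`, may be moved across the integral.
  have hfix : (∫ s in (0 : ℝ)..t, u s) = R ((∫ s in (0 : ℝ)..t, u s) - (u t - u₀)) := by
    rw [← hftc, ← intervalIntegral.integral_sub hi hdi,
      ← ContinuousLinearMap.intervalIntegral_comp_comm _ (hi.sub hdi)]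
    refine intervalIntegral.integral_congr fun s hs => ?_
    rw [uIcc_of_le ht] at hs
    have := hR.left_inv ⟨u s, hu.mem_domain s hs.1⟩
    rw [Complex.ofReal_one, one_smul] at this
    simp only [hd s hs.1, this]
  obtain ⟨hx, hAx⟩ := hR.mem_of_eq hfix
  refine ⟨hx, ?_⟩
  rw [hAx]
  simp

/-- If `v` is the mild solution starting at `A u₀`, then `w = u₀ + ∫ v` satisfies `w' = v = A u₀ + A
∫ v = A w`. Hence `w` is classical, therefore mild, and equals `u` by uniqueness. -/
theorem IsMildSolution.isClassicalSolution (hA : IsMDissipative A) (h₀ : u₀ ∈ A.domain)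
    (hu : IsMildSolution A u₀ u) : IsClassicalSolution A u₀ u := by
  obtain ⟨v, hv, -⟩ := hA.exists_mildSolution (A ⟨u₀, h₀⟩)
  have key : ∀ t, 0 ≤ t → ∃ h : u₀ + (∫ s in (0 : ℝ)..t, v s) ∈ A.domain,
      A ⟨u₀ + ∫ s in (0 : ℝ)..t, v s, h⟩ = v t := by
    intro t ht
    obtain ⟨h₁, e₁⟩ := hv.integrated t ht
    refine ⟨A.domain.add_mem h₀ h₁, ?_⟩
    have h₂ := A.map_add ⟨_, h₀⟩ ⟨_, h₁⟩
    rw [e₁, ← h₂]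
    rfl
  have hwd : ∀ t, 0 ≤ t →
      HasDerivWithinAt (fun t => u₀ + ∫ s in (0 : ℝ)..t, v s) (v t) (Ici 0) t := fun t ht =>
    (hasDerivWithinAt_integral_Ici hv.continuousOn ht).const_add u₀
  -- Needed for `w = u₀ + ∫ v` and again for `u`, which is known to agree with it only on `[0, ∞)`.
  have of_eqOn : ∀ w : ℝ → E, EqOn w (fun t => u₀ + ∫ s in (0 : ℝ)..t, v s) (Ici 0) →
      IsClassicalSolution A u₀ w := by
    intro w hw
    have hmem : ∀ t, 0 ≤ t → ∃ h : w t ∈ A.domain, A ⟨w t, h⟩ = v t := by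
      intro t ht
      rw [hw ht]
      exact key t ht
    have hd : ∀ t, 0 ≤ t → HasDerivWithinAt w (v t) (Ici 0) t := fun t ht =>
      (hwd t ht).congr hw (hw ht)
    have hwc : ContinuousOn w (Ici 0) := fun t ht => (hd t ht).continuousWithinAt
    refine ⟨by simp [hw (mem_Ici.2 le_rfl)], ?_, fun t ht => (hmem t ht).1, ?_, fun t ht => ?_⟩
    · refine (contDiffOn_succ_iff_derivWithin (n := 0) (uniqueDiffOn_Ici 0)).2
        ⟨fun t ht => (hd t ht).differentiableWithinAt, by simp, ?_⟩
      rw [contDiffOn_zero]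
      exact hv.continuousOn.congr fun t ht => (hd t ht).derivWithin (uniqueDiffOn_Ici 0 t ht)
    · refine (continuousOn_iff_continuous_domRestrict.1 hwc).prodMk ?_
      exact (continuousOn_iff_continuous_domRestrict.1 hv.continuousOn).congr
        fun t => ((hmem t t.2).2).symm
    · rw [(hmem t ht).2]
      exact hd t ht
  exact of_eqOn u (hu.eqOn hA ((of_eqOn _ fun _ _ => rfl).isMildSolution hA))

/-! ### Dissipative operators that are onto -/

omit [CompleteSpace E] in
-- Minty's trick: test with `r x`, where `A x = y`, divide by `r > 0` and let `r → 0`; what remains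
-- is `‖y‖² ≤ 0`. It yields both the injectivity of `A` and the closed graph of its inverse.
lemma eq_zero_of_forall_re_inner_nonpos (hs : ∀ f : E, ∃ x : A.domain, A x = f) {y : E}
    (h : ∀ x : A.domain, (inner ℂ (A x) ((x : E) + y)).re ≤ 0) : y = 0 := by
  obtain ⟨x, hx⟩ := hs y
  have h₁ : ∀ r : ℝ, 0 < r → r * (inner ℂ y (x : E)).re + ‖y‖ ^ 2 ≤ 0 := by
    intro r hr
    have h₂ := h ((r : ℂ) • x)
    have h₃ : (inner ℂ ((r : ℂ) • y) ((r : ℂ) • (x : E) + y)).re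
        = r * (r * (inner ℂ y (x : E)).re + ‖y‖ ^ 2) := by
      rw [inner_smul_left, inner_add_right, inner_smul_right, inner_self_eq_norm_sq_to_K]
      simp [← Complex.ofReal_pow]
    rw [A.map_smul, hx, Submodule.coe_smul, h₃] at h₂
    exact nonpos_of_mul_nonpos_right h₂ hr
  have h₂ : Tendsto (fun r : ℝ => r * (inner ℂ y (x : E)).re + ‖y‖ ^ 2) (𝓝[>] 0)
      (𝓝 (0 * (inner ℂ y (x : E)).re + ‖y‖ ^ 2)) :=
    ((continuous_id.mul continuous_const).add continuous_const).continuousAt.tendsto.mono_left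
      nhdsWithin_le_nhds
  have h₃ := le_of_tendsto h₂ (eventually_mem_nhdsWithin.mono h₁)
  rw [zero_mul, zero_add] at h₃
  exact norm_eq_zero.1 (sq_eq_zero_iff.1 (le_antisymm h₃ (sq_nonneg _)))

/-- As in Lax–Milgram: coercivity bounds `T` from below, so its range is closed, and a vector `h`
orthogonal to the range has `‖h‖² ≤ Re ⟨T h, h⟩ = 0`. -/
lemma surjective_of_norm_sq_le_re_inner {T : E →L[ℂ] E}
    (hT : ∀ g, ‖g‖ ^ 2 ≤ (inner ℂ (T g) g).re) : Function.Surjective T := by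
  have hb : ∀ g, ‖g‖ ≤ ‖T g‖ := by
    intro g
    have h₁ := (hT g).trans ((Complex.re_le_norm _).trans (norm_inner_le_norm (𝕜 := ℂ) _ _))
    rcases (norm_nonneg g).eq_or_lt with h | h
    · rw [← h]
      exact norm_nonneg _
    · rw [sq] at h₁
      exact le_of_mul_le_mul_right h₁ h
  have hanti : AntilipschitzWith 1 T := T.antilipschitz_of_bound fun g => by simpa using hb g
  have hclosed : IsClosed (T.range : Set E) := hanti.isClosed_range T.uniformContinuous
  have htop : T.range = ⊤ := by
    rw [← hclosed.submodule_topologicalClosure_eq, Submodule.topologicalClosure_eq_top_iff,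
      Submodule.eq_bot_iff]
    intro h hh
    have h₀ : inner ℂ (T h) h = 0 := 
      Submodule.inner_right_of_mem_orthogonal (LinearMap.mem_range_self _ h) hh
    have h₁ := hT h
    rw [h₀, Complex.zero_re] at h₁
    exact norm_eq_zero.1 (sq_eq_zero_iff.1 (le_antisymm h₁ (sq_nonneg _)))
  exact LinearMap.range_eq_top.1 htop

/-- A dissipative operator that is onto is m-dissipative: its inverse is a monotone operator
defined everywhere, hence bounded. -/
theorem isMDissipative_of_surjective
    (hd : ∀ x : A.domain, (inner ℂ (A x) (x : E)).re ≤ 0)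
    (hs : ∀ f : E, ∃ x : A.domain, A x = f) : IsMDissipative A := by
  have hker : ∀ x : A.domain, A x = 0 → x = 0 := fun x hx =>
    Subtype.ext <| eq_zero_of_forall_re_inner_nonpos hs fun z => by
      simpa [A.map_add, hx] using hd (z + x)
  have hinj : ∀ x y : A.domain, A x = A y → x = y := fun x y h =>
    sub_eq_zero.1 (hker _ (by rw [A.map_sub, h, sub_self]))
  choose b hb using hs
  let B₀ : E →ₗ[ℂ] E :=
    { toFun := fun f => b f
      map_add' := fun f g => by
        rw [hinj (b (f + g)) (b f + b g) (by rw [A.map_add, hb, hb, hb])]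
        rfl
      map_smul' := fun c f => by
        rw [hinj (b (c • f)) (c • b f) (by rw [A.map_smul, hb, hb])]
        rfl }
  let B : E →L[ℂ] E := ContinuousLinearMap.ofSeqClosedGraph (g := B₀) <| by
    intro f x y hf hy
    have h₀ : y - b x = 0 := by
      refine eq_zero_of_forall_re_inner_nonpos (fun f => ⟨b f, hb f⟩) fun z => ?_
      have h₁ : Tendsto (fun n => (inner ℂ (A z + (f n - x)) ((z : E) + (b (f n) - b x))).re)
          atTop (𝓝 (inner ℂ (A z + (x - x)) ((z : E) + (y - b x))).re) :=
        (Complex.continuous_re.tendsto _).comp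
          (((hf.sub_const x).const_add (A z)).inner ((hy.sub_const _).const_add _))
      rw [sub_self, add_zero] at h₁
      refine le_of_tendsto h₁ (Eventually.of_forall fun n => ?_)
      have h₂ := hd (z + (b (f n) - b x))
      rwa [A.map_add, A.map_sub, hb, hb] at h₂
    exact sub_eq_zero.1 h₀
  have hB : ∀ f, B f = b f := fun f => rfl
  refine ⟨hd, fun l hl f => ?_⟩
  -- Since `Re ⟨B g, g⟩ = Re ⟨B g, A B g⟩ ≤ 0`, the operator `1 - l B` is coercive. Solving `g - l B
  -- g = -f` makes `x = B g` a solution of `l x - A x = f`.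
  obtain ⟨g, hg⟩ := surjective_of_norm_sq_le_re_inner (T := 1 - (l : ℂ) • B) (fun g => by
    have h₁ : (1 - (l : ℂ) • B) g = g - (l : ℂ) • (b g : E) := rfl
    have h₂ := hd (b g)
    rw [hb, ← inner_conj_symm, Complex.conj_re] at h₂
    rw [h₁, inner_sub_left, inner_smul_left, inner_self_eq_norm_sq_to_K]
    simp [← Complex.ofReal_pow]
    nlinarith) (-f)
  refine ⟨b g, ?_⟩
  have h₁ : g - (l : ℂ) • (b g : E) = -f := hg
  rw [hb, ← neg_sub, h₁, neg_neg]

end Cauchy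

/-! ### Primitives of integrable functions -/

section Primitive

variable {a b : ℝ} {g h P Q : ℝ → ℂ}

/-- `P` is a primitive of `g` on `[a,b]`. -/
def IsPrimitive (a b : ℝ) (P g : ℝ → ℂ) : Prop :=
  ∀ x ∈ Icc a b, P x = P a + ∫ t in a..x, g t

lemma IsPrimitive.continuousOn (hP : IsPrimitive a b P g) (hg : IntervalIntegrable g volume a b)
    (hab : a ≤ b) : ContinuousOn P (Icc a b) := by
  have := intervalIntegral.continuousOn_primitive_interval' hg (left_mem_uIcc)
  rw [uIcc_of_le hab] at this
  exact (this.const_add (P a)).congr hP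

lemma isPrimitive_of_hasDerivAt (hP : ∀ x, HasDerivAt P (g x) x) (hg : Continuous g) :
    IsPrimitive a b P g := by
  intro x _
  rw [intervalIntegral.integral_eq_sub_of_hasDerivAt (fun t _ => hP t)
    (hg.intervalIntegrable a x)]
  ring

lemma exists_absolutelyContinuous_primitive (hab : a ≤ b) (hg : IntervalIntegrable g volume a b) :
    ∃ G : ℝ → ℂ, AbsolutelyContinuousOnInterval G a b ∧
      (∀ᵐ x, x ∈ Icc a b → HasDerivAt G (g x) x) ∧ ∀ x ∈ Icc a b, G x = ∫ t in a..x, g t := by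
  have hre : IntervalIntegrable (fun x => (g x).re) volume a b := ⟨hg.1.re, hg.2.re⟩
  have him : IntervalIntegrable (fun x => (g x).im) volume a b := ⟨hg.1.im, hg.2.im⟩
  have hconst : ∀ c : ℂ, AbsolutelyContinuousOnInterval (fun _ => c) a b := fun c =>
    contDiffOn_const.absolutelyContinuousOnInterval
  refine ⟨(fun x => ∫ t in a..x, (g t).re) • (fun _ => (1 : ℂ))
    + (fun x => ∫ t in a..x, (g t).im) • (fun _ => Complex.I), ?_, ?_, ?_⟩
  · exact ((hre.absolutelyContinuousOnInterval_intervalIntegral left_mem_uIcc).smul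
      (hconst 1)).add ((him.absolutelyContinuousOnInterval_intervalIntegral left_mem_uIcc).smul
      (hconst Complex.I))
  · filter_upwards [hre.ae_hasDerivAt_integral, him.ae_hasDerivAt_integral] with x h₁ h₂ hx
    rw [← uIcc_of_le hab] at hx
    refine (((h₁ hx a left_mem_uIcc).smul_const (1 : ℂ)).add
      ((h₂ hx a left_mem_uIcc).smul_const Complex.I)).congr_deriv ?_
    apply Complex.ext <;> simp
  · intro x hx
    have hgx : IntervalIntegrable g volume a x := hg.mono_set (by
      rw [uIcc_of_le hx.1, uIcc_of_le hab]
      exact Icc_subset_Icc_right hx.2)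
    have h₁ := Complex.reCLM.intervalIntegral_comp_comm hgx
    have h₂ := Complex.imCLM.intervalIntegral_comp_comm hgx
    simp only [Complex.reCLM_apply, Complex.imCLM_apply] at h₁ h₂
    apply Complex.ext <;> simp [h₁, h₂]

/-- Integration by parts for merely integrable derivatives: `P Q` minus a primitive of `g Q + P h`
is absolutely continuous with derivative zero almost everywhere, hence constant. -/
lemma integral_mul_primitive (hab : a ≤ b) (hg : IntervalIntegrable g volume a b)
    (hh : IntervalIntegrable h volume a b) (hP : IsPrimitive a b P g) (hQ : IsPrimitive a b Q h) :
    ∫ x in a..b, (g x * Q x + P x * h x) = P b * Q b - P a * Q a := by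
  have hPc := hP.continuousOn hg hab
  have hQc := hQ.continuousOn hh hab
  have hk : IntervalIntegrable (fun x => g x * Q x + P x * h x) volume a b := by
    rw [← uIcc_of_le hab] at hPc hQc
    exact (hg.mul_continuousOn hQc).add (hh.continuousOn_mul hPc)
  obtain ⟨G, hG, hG', hGe⟩ := exists_absolutelyContinuous_primitive hab hg
  obtain ⟨H, hH, hH', hHe⟩ := exists_absolutelyContinuous_primitive hab hh
  obtain ⟨K, hK, hK', hKe⟩ := exists_absolutelyContinuous_primitive hab hk
  have hconst : ∀ c : ℂ, AbsolutelyContinuousOnInterval (fun _ => c) a b := fun c =>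
    contDiffOn_const.absolutelyContinuousOnInterval
  have hW := (((hconst (P a)).add hG).smul ((hconst (Q a)).add hH)).sub hK
  obtain ⟨C, hC⟩ := hW.const_of_ae_hasDerivAt_zero (by
    filter_upwards [hG', hH', hK'] with x h₁ h₂ h₃ hx
    rw [uIcc_of_le hab] at hx
    refine (((h₁ hx).const_add (P a)).mul ((h₂ hx).const_add (Q a)) |>.sub (h₃ hx)).congr_deriv ?_
    simp only [hGe x hx, hHe x hx, hP x hx, hQ x hx]
    ring)
  have ha : a ∈ Icc a b := left_mem_Icc.2 hab
  have hb : b ∈ Icc a b := right_mem_Icc.2 hab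
  have h₁ : (P a + G b) * (Q a + H b) - K b = (P a + G a) * (Q a + H a) - K a :=
    (hC b right_mem_uIcc).trans (hC a left_mem_uIcc).symm
  rw [hGe a ha, hHe a ha, hKe a ha, hGe b hb, hHe b hb, hKe b hb] at h₁
  simp only [intervalIntegral.integral_same] at h₁
  rw [hP b hb, hQ b hb]
  linear_combination -h₁

/-- The primitive from `a` vanishes to the left of the support of `η`, and to its right because the
total integral is zero. -/
lemma exists_test_primitive {η : ℝ → ℝ} (hη : ContDiff ℝ ∞ η) (hc : HasCompactSupport η)
    (hs : tsupport η ⊆ Ioo a b) (h₀ : ∫ x, η x = 0) :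
    ∃ φ : ℝ → ℝ, ContDiff ℝ ∞ φ ∧ HasCompactSupport φ ∧ tsupport φ ⊆ Ioo a b ∧ deriv φ = η := by
  rcases (tsupport η).eq_empty_or_nonempty with he | hne
  · have hz : η = 0 := by
      ext x
      exact image_eq_zero_of_notMem_tsupport (by simp [he])
    exact ⟨0, contDiff_const, HasCompactSupport.zero, by simp [tsupport], by simp [hz]⟩
  obtain ⟨c, hcm, hcl⟩ := hc.isCompact.exists_isLeast hne
  obtain ⟨d, hdm, hdg⟩ := hc.isCompact.exists_isGreatest hne
  have hcd : Icc c d ⊆ Ioo a b := fun x hx => ⟨(hs hcm).1.trans_le hx.1, hx.2.trans_lt (hs hdm).2⟩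
  have hout : ∀ x, x ∉ Icc c d → η x = 0 := fun x hx =>
    image_eq_zero_of_notMem_tsupport fun h => hx ⟨hcl h, hdg h⟩
  have hd : ∀ x, HasDerivAt (fun x => ∫ t in a..x, η t) (η x) x := fun x =>
    intervalIntegral.integral_hasDerivAt_right (hη.continuous.intervalIntegrable _ _)
      (hη.continuous.stronglyMeasurableAtFilter _ _) hη.continuous.continuousAt
  have hderiv : deriv (fun x => ∫ t in a..x, η t) = η := funext fun x => (hd x).deriv
  have hsupp : Function.support (fun x => ∫ t in a..x, η t) ⊆ Icc c d := by
    intro x hx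
    by_contra hxn
    refine hx ?_
    rcases lt_or_ge x c with h | h
    · refine intervalIntegral.integral_zero_ae (Eventually.of_forall fun t ht => hout t fun h' => ?_)
      rcases mem_uIoc.1 ht with h₁ | h₁
      · exact absurd (h'.1.trans h₁.2) (not_le.2 h)
      · exact absurd (h'.1.trans h₁.2) (not_le.2 (hs hcm).1)
    · have hx' : d < x := not_le.1 fun h' => hxn ⟨h, h'⟩
      have hax : a ≤ x := (hs hdm).1.le.trans hx'.le
      change ∫ t in a..x, η t = 0
      rw [intervalIntegral.integral_of_le hax, ← h₀]
      refine setIntegral_eq_integral_of_forall_compl_eq_zero fun t ht => hout t fun h' => ht ?_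
      exact ⟨(hcd h').1, h'.2.trans hx'.le⟩
  have hts : tsupport (fun x => ∫ t in a..x, η t) ⊆ Icc c d :=
    closure_minimal hsupp isClosed_Icc
  refine ⟨_, contDiff_infty_iff_deriv.2 ⟨fun x => (hd x).differentiableAt, ?_⟩,
    HasCompactSupport.of_support_subset_isCompact isCompact_Icc hsupp, hts.trans hcd, hderiv⟩
  rw [hderiv]
  exact hη

/-- The lemma of du Bois-Reymond. -/
lemma eq_left_of_integral_deriv_smul_eq_zero (hab : a < b) {D : ℝ → ℂ}
    (hD : ContinuousOn D (Icc a b))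
    (h : ∀ φ : ℝ → ℝ, ContDiff ℝ ∞ φ → HasCompactSupport φ → tsupport φ ⊆ Ioo a b →
      ∫ x in Ioo a b, deriv φ x • D x = 0) : ∀ x ∈ Icc a b, D x = D a := by
  have hint : ∀ {ψ : ℝ → ℝ} {F : ℝ → ℂ}, Continuous ψ → ContinuousOn F (Icc a b) →
      IntegrableOn (fun x => ψ x • F x) (Ioo a b) := fun hψ hF =>
    ((hψ.continuousOn.smul hF).integrableOn_Icc).mono_set Ioo_subset_Icc_self
  let β : ContDiffBump ((a + b) / 2) := ⟨(b - a) / 8, (b - a) / 4, by linarith, by linarith⟩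
  set ψ₀ : ℝ → ℝ := β.normed volume
  have hψ₀ : ContDiff ℝ ∞ ψ₀ := β.contDiff_normed
  have hψ₀c : HasCompactSupport ψ₀ := β.hasCompactSupport_normed
  have hψ₀s : tsupport ψ₀ ⊆ Ioo a b := by
    rw [β.tsupport_normed_eq, Real.closedBall_eq_Icc]
    intro x hx
    have h₁ := hx.1
    have h₂ := hx.2
    simp only [β] at h₁ h₂
    constructor <;> linarith
  have hψ₀i : ∫ x, ψ₀ x = 1 := β.integral_normed
  have hset : ∀ {ψ : ℝ → ℝ}, tsupport ψ ⊆ Ioo a b → ∀ x, x ∉ Ioo a b → ψ x = 0 :=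
    fun hs x hx => image_eq_zero_of_notMem_tsupport fun h' => hx (hs h')
  set c : ℂ := ∫ x in Ioo a b, ψ₀ x • D x
  have key : ∀ᵐ x, x ∈ Ioo a b → D x - c = 0 := by
    refine IsOpen.ae_eq_zero_of_integral_contDiff_smul_eq_zero isOpen_Ioo (f := fun x => D x - c)
      ?_ ?_
    · exact ((hD.sub continuousOn_const).integrableOn_Icc.mono_set
        Ioo_subset_Icc_self).locallyIntegrableOn
    · intro ψ h₁ h₂ h₃
      set r : ℝ := ∫ x, ψ x
      -- Subtracting `r ψ₀` from `ψ` makes the mean zero, so the hypothesis applies and gives `∫ ψ D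
      -- = r c`, with `c` the `ψ₀`-average of `D`.
      obtain ⟨φ, hφ, hφc, hφs, hφd⟩ := exists_test_primitive (a := a) (b := b)
        (η := fun x => ψ x - r * ψ₀ x) (h₁.sub (contDiff_const.mul hψ₀))
        (h₂.sub (hψ₀c.mul_left (f := fun _ => r)))
        ((tsupport_sub ψ fun x => r * ψ₀ x).trans (union_subset h₃
          ((tsupport_mul_subset_right (f := fun _ => r)).trans hψ₀s)))
        (by
          rw [integral_sub (h₁.continuous.integrable_of_hasCompactSupport h₂)
            ((hψ₀.continuous.integrable_of_hasCompactSupport hψ₀c).const_mul r),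
            integral_const_mul, hψ₀i, mul_one, sub_self])
      have h₄ := h φ hφ hφc hφs
      rw [hφd] at h₄
      have h₅ : ∫ x in Ioo a b, ψ x = r :=
        setIntegral_eq_integral_of_forall_compl_eq_zero (hset h₃)
      rw [← setIntegral_eq_integral_of_forall_compl_eq_zero (s := Ioo a b)
        (fun x hx => by simp [hset h₃ x hx])]
      simp only [smul_sub]
      rw [integral_sub (hint h₁.continuous hD) (hint h₁.continuous continuousOn_const),
        integral_smul_const, h₅]
      have h₆ : ∀ x, (ψ x - r * ψ₀ x) • D x = ψ x • D x - r • (ψ₀ x • D x) := fun x => by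
        rw [sub_smul, mul_smul]
      simp only [h₆] at h₄
      have h₇ : IntegrableOn (fun x => r • (ψ₀ x • D x)) (Ioo a b) :=
        (hint hψ₀.continuous hD).smul r
      rw [integral_sub (hint h₁.continuous hD) h₇, integral_smul] at h₄
      exact h₄
  have hae : D =ᵐ[volume.restrict (Icc a b)] fun _ => c := by
    rw [← restrict_Ioo_eq_restrict_Icc, Filter.EventuallyEq, ae_restrict_iff' measurableSet_Ioo]
    filter_upwards [key] with x hx hm
    exact sub_eq_zero.1 (hx hm)
  have heq := Measure.eqOn_Icc_of_ae_eq volume hab.ne hae hD continuousOn_const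
  intro x hx
  rw [heq hx, heq (left_mem_Icc.2 hab.le)]

end Primitive

/-! ### Weak derivatives and continuous representatives -/

section WeakDeriv

variable {a b : ℝ} {f g : L2 a b} {F : ℝ → ℂ}

lemma L2.intervalIntegrable (f : L2 a b) (hab : a ≤ b) : IntervalIntegrable f volume a b := by
  rw [intervalIntegrable_iff_integrableOn_Ioo_of_le hab]
  exact (Lp.memLp f).integrable (by norm_num)

lemma integral_deriv_smul_primitive (hab : a ≤ b) {G h : ℝ → ℂ}
    (hh : IntervalIntegrable h volume a b) (hG : IsPrimitive a b G h) {φ : ℝ → ℝ}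
    (hφ : ContDiff ℝ ∞ φ) (hs : tsupport φ ⊆ Ioo a b) :
    ∫ x in Ioo a b, deriv φ x • G x = -∫ x in Ioo a b, φ x • h x := by
  have hφd : ∀ x, HasDerivAt φ (deriv φ x) x := fun x =>
    (hφ.differentiable (by simp) x).hasDerivAt
  have hdc : Continuous (deriv φ) := hφ.continuous_deriv (by simp)
  have hGc := hG.continuousOn hh hab
  rw [← uIcc_of_le hab] at hGc
  have hdc' : Continuous fun x => ((deriv φ x : ℝ) : ℂ) := Complex.continuous_ofReal.comp hdc
  have hφc' : Continuous fun x => (φ x : ℂ) := Complex.continuous_ofReal.comp hφ.continuous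
  have h₁ := integral_mul_primitive hab (hdc'.intervalIntegrable a b) hh
    (isPrimitive_of_hasDerivAt (P := fun x => (φ x : ℂ)) (fun x => (hφd x).ofReal_comp) hdc')
    hG
  have hz : ∀ x, x ∉ Ioo a b → φ x = 0 :=
    fun x hx => image_eq_zero_of_notMem_tsupport fun h' => hx (hs h')
  rw [hz a (by simp), hz b (by simp), intervalIntegral.integral_add
    ((hdc'.intervalIntegrable a b).mul_continuousOn hGc)
    (hh.continuousOn_mul hφc'.continuousOn)] at h₁
  simp only [Complex.ofReal_zero, zero_mul, sub_zero] at h₁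
  rw [intervalIntegral.integral_of_le hab, intervalIntegral.integral_of_le hab,
    integral_Ioc_eq_integral_Ioo, integral_Ioc_eq_integral_Ioo] at h₁
  simp only [Complex.real_smul]
  exact eq_neg_of_add_eq_zero_left h₁

lemma isWeakDeriv_of_isPrimitive (hab : a ≤ b) (hF : IsPrimitive a b F g)
    (hf : f =ᵐ[volume.restrict (Ioo a b)] F) : IsWeakDeriv f g := by
  intro φ h₁ _ h₃
  rw [← integral_deriv_smul_primitive hab (L2.intervalIntegrable g hab) hF h₁ h₃]
  exact integral_congr_ae (hf.mono fun x hx => by simp only [hx])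

/-- The difference `F - ∫ g` integrates to zero against every `φ'`, so it is constant by du
Bois-Reymond. -/
lemma IsWeakDeriv.isPrimitive (hab : a < b) (hg : IsWeakDeriv f g) (hF : IsContRep f F) :
    IsPrimitive a b F g := by
  have hgi := L2.intervalIntegrable g hab.le
  have hG : IsPrimitive a b (fun x => ∫ t in a..x, g t) g := fun x _ => by simp
  have hGc := hG.continuousOn hgi hab.le
  have h := eq_left_of_integral_deriv_smul_eq_zero hab
    (D := fun x => F x - ∫ t in a..x, g t) (hF.1.sub hGc) fun φ h₁ h₂ h₃ => by
    have hdc : Continuous (deriv φ) := h₁.continuous_deriv (by simp)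
    have hint : ∀ {K : ℝ → ℂ}, ContinuousOn K (Icc a b) →
        IntegrableOn (fun x => deriv φ x • K x) (Ioo a b) := fun hK =>
      ((hdc.continuousOn.smul hK).integrableOn_Icc).mono_set Ioo_subset_Icc_self
    have h₄ := hg φ h₁ h₂ h₃
    rw [← integral_deriv_smul_primitive hab.le hgi hG h₁ h₃] at h₄
    simp only [smul_sub]
    rw [integral_sub (hint hF.1) (hint hGc), ← h₄, sub_eq_zero]
    exact integral_congr_ae (hF.2.mono fun x hx => by simp only [hx])
  intro x hx
  have := h x hx
  simp only [intervalIntegral.integral_same, sub_zero] at this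
  rw [← this]
  ring

end WeakDeriv

/-! ### Green's identity and dissipativity of the chain operator -/

section Green

variable {a b : ℝ}

lemma IsPrimitive.congr_ae {P g g' : ℝ → ℂ} (hP : IsPrimitive a b P g)
    (h : g =ᵐ[volume.restrict (Ioo a b)] g') : IsPrimitive a b P g' := by
  intro x hx
  rw [hP x hx, intervalIntegral.integral_of_le hx.1, intervalIntegral.integral_of_le hx.1,
    integral_Ioc_eq_integral_Ioo, integral_Ioc_eq_integral_Ioo]
  congr 1
  exact integral_congr_ae (ae_restrict_of_ae_restrict_of_subset (Ioo_subset_Ioo_right hx.2) h)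

lemma IsPrimitive.conj {P g : ℝ → ℂ} (hP : IsPrimitive a b P g) :
    IsPrimitive a b (fun x => (starRingEnd ℂ) (P x)) (fun x => (starRingEnd ℂ) (g x)) := by
  intro x hx
  beta_reduce
  rw [hP x hx, map_add, intervalIntegral.integral_of_le hx.1, intervalIntegral.integral_of_le hx.1,
    integral_conj]

lemma L2.norm_sq_eq_integral (f : L2 a b) : ‖f‖ ^ 2 = ∫ x in Ioo a b, ‖f x‖ ^ 2 := by
  rw [← inner_self_eq_norm_sq (𝕜 := ℂ) f, L2.inner_def]
  simp only [inner_self_eq_norm_sq_to_K]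
  have h : ∀ x, ((‖f x‖ : ℂ)) ^ 2 = ((‖f x‖ ^ 2 : ℝ) : ℂ) := fun x => by push_cast; rfl
  change (∫ x in Ioo a b, ((‖f x‖ : ℂ)) ^ 2).re = _
  simp only [h]
  rw [integral_complex_ofReal, Complex.ofReal_re]

/-- Green's identity `Re ⟨-i r f'', f⟩ = Re [i r \overline{f'} f]_a^b`. -/
lemma re_inner_second_deriv (hab : a < b) {f g k : L2 a b} {F G : ℝ → ℂ} (hfg : IsWeakDeriv f g)
    (hgk : IsWeakDeriv g k) (hF : IsContRep f F) (hG : IsContRep g G) (r : ℝ) :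
    (inner ℂ ((-(Complex.I * (r : ℂ))) • k) f).re
      = (Complex.I * ((starRingEnd ℂ) ((r : ℂ) * G b) * F b)).re
        - (Complex.I * ((starRingEnd ℂ) ((r : ℂ) * G a) * F a)).re := by
  have hPF := hfg.isPrimitive hab hF
  have hPG := (hgk.isPrimitive hab hG).conj
  have hgi := L2.intervalIntegrable g hab.le
  have hki : IntervalIntegrable (fun x => (starRingEnd ℂ) (k x)) volume a b :=
    ⟨Complex.conjCLE.integrable_comp_iff.2 (L2.intervalIntegrable k hab.le).1,
      Complex.conjCLE.integrable_comp_iff.2 (L2.intervalIntegrable k hab.le).2⟩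
  have hFc := hF.1
  have hGc : ContinuousOn (fun x => (starRingEnd ℂ) (G x)) (Icc a b) :=
    Complex.continuous_conj.comp_continuousOn hG.1
  rw [← uIcc_of_le hab.le] at hFc hGc
  have h₁ := integral_mul_primitive hab.le hki hgi hPG hPF
  rw [intervalIntegral.integral_add (hki.mul_continuousOn hFc) (hgi.continuousOn_mul hGc),
    intervalIntegral.integral_of_le hab.le, intervalIntegral.integral_of_le hab.le,
    integral_Ioc_eq_integral_Ioo, integral_Ioc_eq_integral_Ioo] at h₁
  have h₂ : ∫ x in Ioo a b, (starRingEnd ℂ) (k x) * F x = inner ℂ k f := by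
    rw [L2.inner_def]
    refine integral_congr_ae (hF.2.mono fun x hx => ?_)
    simp only [hx, RCLike.inner_apply, mul_comm]
  -- This integral is real, so multiplied by `i r` it drops out of the real part.
  have h₃ : ∫ x in Ioo a b, (starRingEnd ℂ) (G x) * g x
      = ((∫ x in Ioo a b, ‖g x‖ ^ 2 : ℝ) : ℂ) := by
    rw [← integral_complex_ofReal]
    refine integral_congr_ae (hG.2.mono fun x hx => ?_)
    simp only [← hx]
    rw [mul_comm, Complex.mul_conj, Complex.normSq_eq_norm_sq]
  rw [h₂, h₃, ← eq_sub_iff_add_eq] at h₁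
  rw [inner_smul_left, h₁]
  simp
  ring

/-- The operator picks its second derivative by choice; uniqueness of weak derivatives allows any
explicit `w` instead. -/
lemma chainOperator_apply {n : ℕ} {ρ : Fin (n + 1) → ℝ} {u w : ChainL2 n} (h : InDomain ρ u w) :
    ∃ hu : u ∈ (chainOperator ρ).domain,
      chainOperator ρ ⟨u, hu⟩ = WithLp.toLp 2 fun j => (-(Complex.I * (ρ j : ℂ))) • w j := by
  refine ⟨⟨w, h⟩, ?_⟩
  have e : secondDeriv ρ ⟨u, ⟨w, h⟩⟩ = w := InDomain.unique (Exists.choose_spec _) h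
  change coefficient ρ (secondDeriv ρ ⟨u, ⟨w, h⟩⟩) = _
  rw [e]
  rfl

lemma re_inner_chainOperator {n : ℕ} {ρ : Fin (n + 1) → ℝ} (u : (chainOperator ρ).domain) :
    ∃ U : ℝ → ℂ, IsContRep ((u : ChainL2 n) 0) U ∧
      (inner ℂ (chainOperator ρ u) (u : ChainL2 n)).re = -‖U 0‖ ^ 2 := by
  obtain ⟨u, w, v, huv, hvw, U, V, hU, hV, hvert⟩ := u
  obtain ⟨hu, hAu⟩ := chainOperator_apply ⟨v, huv, hvw, U, V, hU, hV, hvert⟩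
  refine ⟨U 0, hU 0, ?_⟩
  rw [hAu, PiLp.inner_apply, Complex.re_sum]
  simp only [re_inner_second_deriv (lt_add_one _) (huv _) (hvw _) (hU _) (hV _)]
  -- The last term is split off the right-endpoint sum and the first off the left-endpoint sum. Both
  -- remaining sums then run over the interior vertices, where they cancel.
  rw [Finset.sum_sub_distrib, Fin.sum_univ_castSucc, Fin.sum_univ_succ (n := n)]
  have hlast : U (Fin.last n) (((Fin.last n : Fin (n + 1)) : ℕ) + 1) = 0 := by
    simpa using hvert.dirichlet
  have hmid : ∀ j : Fin n, (Complex.I * ((starRingEnd ℂ) ((ρ j.castSucc : ℂ) *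
        V j.castSucc (((j.castSucc : Fin (n + 1)) : ℕ) + 1)) *
        U j.castSucc (((j.castSucc : Fin (n + 1)) : ℕ) + 1))).re
      = (Complex.I * ((starRingEnd ℂ) ((ρ j.succ : ℂ) *
        V j.succ (((j.succ : Fin (n + 1)) : ℕ) : ℝ)) *
        U j.succ (((j.succ : Fin (n + 1)) : ℕ) : ℝ))).re := by
    intro j
    have h₁ := hvert.continuity j
    have h₂ := neg_add_eq_zero.1 (hvert.kirchhoff j)
    simp only [Fin.val_castSucc, Fin.val_succ, Nat.cast_add, Nat.cast_one]
    rw [h₁, h₂]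
  have hzero : (Complex.I * ((starRingEnd ℂ) ((ρ 0 : ℂ) * V 0 (((0 : Fin (n + 1)) : ℕ) : ℝ)) *
      U 0 (((0 : Fin (n + 1)) : ℕ) : ℝ))).re = ‖U 0 0‖ ^ 2 := by
    simp only [Fin.val_zero, Nat.cast_zero]
    rw [hvert.damping, ← Complex.normSq_eq_norm_sq, Complex.normSq_apply]
    simp [add_comm]
  rw [hlast, hzero, Finset.sum_congr rfl fun j _ => hmid j]
  simp

lemma energy_eq {n : ℕ} (u : ChainL2 n) : energy u = 1 / 2 * ‖u‖ ^ 2 := by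
  rw [energy, PiLp.norm_sq_eq_of_L2]
  simp only [L2.norm_sq_eq_integral]

end Green

/-! ### Surjectivity of the chain operator -/

section Surjective

variable {n : ℕ}

/-- The function equal to `h j` on `(j, j+1)` for `j = 0, …, n`, and to zero elsewhere. -/
def glue (h : Fin (n + 1) → ℝ → ℂ) (x : ℝ) : ℂ :=
  ∑ j : Fin (n + 1), (Ioo ((j : ℕ) : ℝ) ((j : ℕ) + 1)).indicator (h j) x

variable {h : Fin (n + 1) → ℝ → ℂ}

lemma glue_apply {j : Fin (n + 1)} {x : ℝ} (hx : x ∈ Ioo ((j : ℕ) : ℝ) ((j : ℕ) + 1)) :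
    glue h x = h j x := by
  rw [glue, Finset.sum_eq_single j, indicator_of_mem hx]
  · intro i _ hij
    refine indicator_of_notMem (fun hi => hij (Fin.ext ?_)) _
    have h₁ : ((i : ℕ) : ℝ) < (j : ℕ) + 1 := hi.1.trans hx.2
    have h₂ : ((j : ℕ) : ℝ) < (i : ℕ) + 1 := hx.1.trans hi.2
    norm_cast at h₁ h₂
    omega
  · simp

lemma integrable_glue
    (hh : ∀ j, IntegrableOn (h j) (Ioo (((j : Fin (n + 1)) : ℕ) : ℝ) ((j : ℕ) + 1))) :
    Integrable (glue h) :=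
  integrable_finsetSum _ fun j _ => (integrable_indicator_iff measurableSet_Ioo).2 (hh j)

/-- One primitive on the whole line serves all intervals, so continuity across the vertices is
automatic. -/
lemma isPrimitive_glue
    (hh : ∀ j, IntegrableOn (h j) (Ioo (((j : Fin (n + 1)) : ℕ) : ℝ) ((j : ℕ) + 1)))
    (j : Fin (n + 1)) :
    IsPrimitive (j : ℕ) ((j : ℕ) + 1) (fun x => ∫ t in (0 : ℝ)..x, glue h t) (h j) := by
  have hi := integrable_glue hh
  have h₁ : IsPrimitive (j : ℕ) ((j : ℕ) + 1) (fun x => ∫ t in (0 : ℝ)..x, glue h t) (glue h) :=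
    fun x _ => (intervalIntegral.integral_add_adjacent_intervals hi.intervalIntegrable
      hi.intervalIntegrable).symm
  exact h₁.congr_ae (ae_restrict_of_forall_mem measurableSet_Ioo fun x hx => glue_apply hx)

lemma exists_isContRep_of_continuous {a b : ℝ} {F : ℝ → ℂ} (hF : Continuous F) :
    ∃ f : L2 a b, IsContRep f F := by
  obtain ⟨C, hC⟩ := isCompact_Icc.exists_bound_of_continuousOn (hF.continuousOn (s := Icc a b))
  have hm : MemLp F 2 (volume.restrict (Ioo a b)) :=
    MemLp.of_bound hF.aestronglyMeasurable C
      (ae_restrict_of_forall_mem measurableSet_Ioo fun x hx => hC x (Ioo_subset_Icc_self hx))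
  exact ⟨hm.toLp F, hF.continuousOn, hm.coeFn_toLp⟩

lemma IsPrimitive.add {a b : ℝ} {P g Q k : ℝ → ℂ} (hP : IsPrimitive a b P g)
    (hQ : IsPrimitive a b Q k) (hab : a ≤ b) (hg : IntervalIntegrable g volume a b)
    (hk : IntervalIntegrable k volume a b) :
    IsPrimitive a b (fun x => P x + Q x) (fun x => g x + k x) := by
  intro x hx
  have hs : uIcc a x ⊆ uIcc a b := by
    rw [uIcc_of_le hx.1, uIcc_of_le hab]
    exact Icc_subset_Icc_right hx.2
  beta_reduce
  rw [hP x hx, hQ x hx, intervalIntegral.integral_add (hg.mono_set hs) (hk.mono_set hs)]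
  ring

lemma IsPrimitive.const_add_mul {a b : ℝ} {P g : ℝ → ℂ} (hP : IsPrimitive a b P g) (c d : ℂ) :
    IsPrimitive a b (fun x => c + d * P x) (fun x => d * g x) := by
  intro x hx
  beta_reduce
  rw [intervalIntegral.integral_const_mul, hP x hx]
  ring

/-- Put `q = u_0(0)`. The flux `ρ u'` is continuous across vertices, starts at `i q` by damping and
has derivative `i f`, so it equals `i q + i F`. Dividing by `ρ` and integrating gives `u = q + i q κ
+ W`; only the Dirichlet condition is left, and it determines `q`. -/
theorem chainOperator_surjective {ρ : Fin (n + 1) → ℝ} (hρ : ∀ j, 0 < ρ j) (f : ChainL2 n) :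
    ∃ u : (chainOperator ρ).domain, chainOperator ρ u = f := by
  have hρ' : ∀ j, (ρ j : ℂ) ≠ 0 := fun j => Complex.ofReal_ne_zero.2 (hρ j).ne'
  have hfi : ∀ j, IntegrableOn (f j) (Ioo (((j : Fin (n + 1)) : ℕ) : ℝ) ((j : ℕ) + 1)) :=
    fun j => (Lp.memLp (f j)).integrable (by norm_num)
  set F : ℝ → ℂ := fun x => ∫ t in (0 : ℝ)..x, glue (fun j => f j) t with hFdef
  have hFc : Continuous F := intervalIntegral.continuous_primitive
    (fun _ _ => (integrable_glue hfi).intervalIntegrable) 0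
  have hci : ∀ {K : ℝ → ℂ}, Continuous K → ∀ j : Fin (n + 1),
      IntegrableOn K (Ioo ((j : ℕ) : ℝ) ((j : ℕ) + 1)) := fun hK j =>
    hK.continuousOn.integrableOn_Icc.mono_set Ioo_subset_Icc_self
  have hκi := fun j : Fin (n + 1) => hci (K := fun _ => (ρ j : ℂ)⁻¹) continuous_const j
  have hFi := fun j : Fin (n + 1) =>
    hci (K := fun x => (ρ j : ℂ)⁻¹ * (Complex.I * F x)) (by fun_prop) j
  set κ : ℝ → ℂ := fun x => ∫ t in (0 : ℝ)..x, glue (fun (j : Fin (n + 1)) _ => (ρ j : ℂ)⁻¹) t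
    with hκdef
  set W : ℝ → ℂ := fun x => ∫ t in (0 : ℝ)..x,
    glue (fun (j : Fin (n + 1)) t => (ρ j : ℂ)⁻¹ * (Complex.I * F t)) t with hWdef
  have hκc : Continuous κ := intervalIntegral.continuous_primitive
    (fun _ _ => (integrable_glue hκi).intervalIntegrable) 0
  have hWc : Continuous W := intervalIntegral.continuous_primitive
    (fun _ _ => (integrable_glue hFi).intervalIntegrable) 0
  have hκim : (κ (n + 1)).im = 0 := by
    have h₁ := Complex.imCLM.intervalIntegral_comp_comm
      ((integrable_glue hκi).intervalIntegrable (a := 0) (b := (n : ℝ) + 1))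
    simp only [Complex.imCLM_apply] at h₁
    rw [hκdef, ← h₁]
    refine intervalIntegral.integral_zero_ae (Eventually.of_forall fun x _ => ?_)
    rw [glue, Complex.im_sum]
    refine Finset.sum_eq_zero fun j _ => ?_
    by_cases hx : x ∈ Ioo ((j : ℕ) : ℝ) ((j : ℕ) + 1)
    · rw [indicator_of_mem hx, ← Complex.ofReal_inv, Complex.ofReal_im]
    · rw [indicator_of_notMem hx, Complex.zero_im]
  -- As `κ (n + 1)` is real, the real part is `1`; so the Dirichlet equation is solvable for `q`.
  have hne : 1 + Complex.I * κ (n + 1) ≠ 0 := fun h0 => by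
    have := congrArg Complex.re h0
    simp [hκim] at this
  set q : ℂ := -W (n + 1) / (1 + Complex.I * κ (n + 1)) with hq
  have hqe : q + Complex.I * q * κ (n + 1) + W (n + 1) = 0 := by
    rw [hq]
    field_simp
    ring
  set U : ℝ → ℂ := fun x => q + Complex.I * q * κ x + W x with hU
  set V : Fin (n + 1) → ℝ → ℂ := fun j x =>
    (ρ j : ℂ)⁻¹ * (Complex.I * q) + (ρ j : ℂ)⁻¹ * Complex.I * F x with hV
  have hUc : Continuous U := by fun_prop
  have hVc : ∀ j, Continuous (V j) := fun j => by fun_prop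
  choose u hu using fun j : Fin (n + 1) =>
    exists_isContRep_of_continuous (a := ((j : ℕ) : ℝ)) (b := (j : ℕ) + 1) hUc
  choose v hv using fun j : Fin (n + 1) =>
    exists_isContRep_of_continuous (a := ((j : ℕ) : ℝ)) (b := (j : ℕ) + 1) (hVc j)
  have hVp : ∀ j : Fin (n + 1), IsPrimitive (j : ℕ) ((j : ℕ) + 1) (V j)
      (fun x => (ρ j : ℂ)⁻¹ * Complex.I * f j x) := fun j =>
    (isPrimitive_glue hfi j).const_add_mul _ _
  have hUp : ∀ j : Fin (n + 1), IsPrimitive (j : ℕ) ((j : ℕ) + 1) U (V j) := by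
    intro j
    have h₁ := ((isPrimitive_glue hκi j).const_add_mul q (Complex.I * q)).add
      (isPrimitive_glue hFi j) (le_add_of_nonneg_right zero_le_one)
      (continuous_const.intervalIntegrable _ _)
      ((by fun_prop : Continuous fun x => (ρ j : ℂ)⁻¹ * (Complex.I * F x)).intervalIntegrable _ _)
    refine h₁.congr_ae (Eventually.of_forall fun x => ?_)
    simp only [hV]
    ring
  let w : ChainL2 n := WithLp.toLp 2 fun j => ((ρ j : ℂ)⁻¹ * Complex.I) • f j
  have hdom : InDomain ρ (WithLp.toLp 2 u) w := by
    refine ⟨WithLp.toLp 2 v, fun j => ?_, fun j => ?_, fun _ => U, V, hu, hv, ?_, hqe,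
      fun _ => rfl, fun j => ?_⟩
    · exact isWeakDeriv_of_isPrimitive (le_add_of_nonneg_right zero_le_one)
        ((hUp j).congr_ae (hv j).2.symm) (hu j).2
    · exact isWeakDeriv_of_isPrimitive (le_add_of_nonneg_right zero_le_one)
        ((hVp j).congr_ae (Lp.coeFn_smul ((ρ j : ℂ)⁻¹ * Complex.I) (f j)).symm) (hv j).2
    · simp only [hV, hU, hFdef, hκdef, hWdef, intervalIntegral.integral_same, mul_zero, add_zero]
      rw [mul_inv_cancel_left₀ (hρ' 0)]
    · simp only [hV]
      field_simp [hρ' j.castSucc, hρ' j.succ]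
      ring
  obtain ⟨hmem, hA⟩ := chainOperator_apply hdom
  refine ⟨⟨_, hmem⟩, ?_⟩
  rw [hA]
  ext1 j
  change (-(Complex.I * (ρ j : ℂ))) • ((ρ j : ℂ)⁻¹ * Complex.I) • f j = f j
  rw [smul_smul]
  have : -(Complex.I * (ρ j : ℂ)) * ((ρ j : ℂ)⁻¹ * Complex.I) = 1 := by
    field_simp [hρ' j]
    simp
  rw [this, one_smul]

end Surjective

/-! ### Application to the chain -/

theorem isMDissipative_chainOperator {n : ℕ} {ρ : Fin (n + 1) → ℝ} (hρ : ∀ j, 0 < ρ j) :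
    IsMDissipative (chainOperator ρ) := by
  refine isMDissipative_of_surjective (fun u => ?_) (chainOperator_surjective hρ)
  obtain ⟨U, -, h⟩ := re_inner_chainOperator u
  rw [h]
  exact neg_nonpos.2 (sq_nonneg _)

end SchrodingerChain

end

theorem proposition5p1 (n : ℕ) (ρ : Fin (n + 1) → ℝ) (hρ : ∀ j, 0 < ρ j) :
    SchrodingerChain.IsMDissipative (SchrodingerChain.chainOperator ρ) ∧
    (∀ u₀ : SchrodingerChain.ChainL2 n,
      (∃ u : ℝ → SchrodingerChain.ChainL2 n,
        SchrodingerChain.IsMildSolution (SchrodingerChain.chainOperator ρ) u₀ u) ∧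
      (∀ u v : ℝ → SchrodingerChain.ChainL2 n,
        SchrodingerChain.IsMildSolution (SchrodingerChain.chainOperator ρ) u₀ u →
        SchrodingerChain.IsMildSolution (SchrodingerChain.chainOperator ρ) u₀ v →
        Set.EqOn u v (Set.Ici 0))) ∧
    (∀ u₀ ∈ (SchrodingerChain.chainOperator ρ).domain, ∀ u : ℝ → SchrodingerChain.ChainL2 n,
      SchrodingerChain.IsMildSolution (SchrodingerChain.chainOperator ρ) u₀ u ↔
        SchrodingerChain.IsClassicalSolution (SchrodingerChain.chainOperator ρ) u₀ u) ∧
    (∀ u₀ ∈ (SchrodingerChain.chainOperator ρ).domain, ∀ u : ℝ → SchrodingerChain.ChainL2 n,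
      SchrodingerChain.IsMildSolution (SchrodingerChain.chainOperator ρ) u₀ u →
      ∀ t : ℝ, 0 ≤ t → ∃ U : ℝ → ℂ, SchrodingerChain.IsContRep (u t 0) U ∧
        HasDerivWithinAt (fun s => SchrodingerChain.energy (u s)) (-‖U 0‖ ^ 2) (Set.Ici 0) t) ∧
    (∀ (u₀ : SchrodingerChain.ChainL2 n) (u : ℝ → SchrodingerChain.ChainL2 n),
      SchrodingerChain.IsMildSolution (SchrodingerChain.chainOperator ρ) u₀ u →
      AntitoneOn (fun t => SchrodingerChain.energy (u t)) (Set.Ici 0)) := by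
  have hA := SchrodingerChain.isMDissipative_chainOperator hρ
  refine ⟨hA, fun u₀ => ⟨?_, fun u v hu hv => hu.eqOn hA hv⟩,
    fun u₀ h₀ u => ⟨fun hu => hu.isClassicalSolution hA h₀, fun hu => hu.isMildSolution hA⟩,
    fun u₀ h₀ u hu t ht => ?_, fun u₀ u hu s hs t ht hst => ?_⟩
  · obtain ⟨u, hu, -⟩ := hA.exists_mildSolution u₀
    exact ⟨u, hu⟩
  · have hc := hu.isClassicalSolution hA h₀
    obtain ⟨U, hU, hd⟩ :=
      SchrodingerChain.re_inner_chainOperator (ρ := ρ) ⟨u t, hc.mem_domain t ht⟩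
    refine ⟨U, hU, ?_⟩
    simp only [SchrodingerChain.energy_eq]
    refine ((SchrodingerChain.hasDerivWithinAt_norm_sq (hc.equation t ht)).const_mul
      (1 / 2)).congr_deriv ?_
    rw [hd]
    ring
  · simp only [SchrodingerChain.energy_eq]
    have := hu.antitoneOn_norm hA hs ht hst
    gcongr
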